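/- Let $\mathbf e=(e_1,\dots,e_r)$ and $\mathbf f=(f_1,\dots,f_s)$ be two sequences of positive integers with no common term, such that $\sum_{i=1}^r e_i=\sum_{j=1}^s f_j$ and such that $$\mathcal Q(n):=\frac{(e_1n)!\cdots(e_rn)!}{(f_1n)!\cdots(f_sn)!}$$ is an integer for every integer $n\ge 0$. Let $M$ be the largest of the numbers $e_1,\dots,e_r,f_1,\dots,f_s$. For $x\in\mathbb R$ put $\Delta(x):=\sum_{i=1}^r\lfloor e_ix\rfloor-\sum_{j=1}^s\lfloor f_jx\rfloor$. Let $H_n:=\sum_{k=1}^n\frac1k$, and define the formal power series $$F(z):=\sum_{n\ge 0}\mathcal Q(n)z^n,\qquad G(z):=\sum_{n\ge 1}\mathcal Q(n)\Big(\sum_{i=1}^r e_iH_{e_in}-\sum_{j=1}^s f_jH_{f_jn}\Big)z^n,$$ $$G_L(z):=\sum_{n\ge 1}\mathcal Q(n)H_{Ln}z^n,\qquad q(z):=z\exp\!\big(G(z)/F(z)\big),\qquad q_L(z):=\exp\!\big(G_L(z)/F(z)\big)\quad(L\ge1).$$ Then exactly one of the following two cases occurs: either $\Delta(x)\ge 1$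 for all $x\in[1/M,1[$, or $\Delta(x)=0$ for some $x\in[1/M,1[$. Moreover: (i) If $\Delta(x)\ge 1$ for all $x\in[1/M,1[$, then $q_L(z)\in\mathbb Z[[z]]$ for every $L\in\{1,\dots,M\}$. (ii) If $\Delta(x)=0$ for some $x\in[1/M,1[$, then for every $L\in\{1,\dots,M\}$ there are only finitely many primes $p$ such that $q_L(z)\in\mathbb Z_p[[z]]$. Furthermore, if $q_L(z)\in\mathbb Z[[z]]$ for every $L\in\{1,\dots,M\}$, then $q(z)\in z\mathbb Z[[z]]$. In particular, if $\Delta(x)\ge 1$ for all $x\in[1/M,1[$, then $q(z)\in z\mathbb Z[[z]]$. -/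

import Mathlib

open scoped Nat

namespace MirrorMap

noncomputable section

variable {r s : ℕ}

/-- The factorial ratio `Q(n) = (e₁n)! ⋯ (e_r n)! / ((f₁n)! ⋯ (f_s n)!)`. -/
def factorialRatio (e : Fin r → ℕ) (f : Fin s → ℕ) (n : ℕ) : ℚ :=
  (∏ i, ((e i * n)! : ℚ)) / ∏ j, ((f j * n)! : ℚ)

/-- The Landau function `Δ(x) = ∑ᵢ ⌊eᵢ x⌋ - ∑ⱼ ⌊fⱼ x⌋`. -/
def landau (e : Fin r → ℕ) (f : Fin s → ℕ) (x : ℝ) : ℤ :=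
  ∑ i, ⌊(e i : ℝ) * x⌋ - ∑ j, ⌊(f j : ℝ) * x⌋

/-- The largest term `M` of the two sequences. -/
def maxTerm (e : Fin r → ℕ) (f : Fin s → ℕ) : ℕ :=
  max (Finset.univ.sup e) (Finset.univ.sup f)

/-- `F(z) = ∑_{n ≥ 0} Q(n) zⁿ`. -/
def seriesF (e : Fin r → ℕ) (f : Fin s → ℕ) : PowerSeries ℚ :=
  PowerSeries.mk fun n => factorialRatio e f n

/-- `G(z) = ∑_{n ≥ 1} Q(n) (∑ᵢ eᵢ H_{eᵢ n} - ∑ⱼ fⱼ H_{fⱼ n}) zⁿ`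
(the term at `n = 0` vanishes, since `H₀ = 0`). -/
def seriesG (e : Fin r → ℕ) (f : Fin s → ℕ) : PowerSeries ℚ :=
  PowerSeries.mk fun n => factorialRatio e f n *
    (∑ i, (e i : ℚ) * harmonic (e i * n) - ∑ j, (f j : ℚ) * harmonic (f j * n))

/-- `G_L(z) = ∑_{n ≥ 1} Q(n) H_{Ln} zⁿ` (the term at `n = 0` vanishes, since `H₀ = 0`). -/
def seriesGL (e : Fin r → ℕ) (f : Fin s → ℕ) (L : ℕ) : PowerSeries ℚ :=
  PowerSeries.mk fun n => factorialRatio e f n * harmonic (L * n)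

/-- `exp(h(z))` for a formal power series `h` with zero constant term. -/
def expOf (h : PowerSeries ℚ) : PowerSeries ℚ :=
  (PowerSeries.exp ℚ).subst h

/-- The canonical coordinate `q(z) = z exp(G(z)/F(z))`. -/
def canonicalCoord (e : Fin r → ℕ) (f : Fin s → ℕ) : PowerSeries ℚ :=
  PowerSeries.X * expOf (seriesG e f * (seriesF e f)⁻¹)

/-- The series `q_L(z) = exp(G_L(z)/F(z))`. -/
def canonicalCoordL (e : Fin r → ℕ) (f : Fin s → ℕ) (L : ℕ) : PowerSeries ℚ :=
  expOf (seriesGL e f L * (seriesF e f)⁻¹)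

/-- `h ∈ ℤ[[z]]`. -/
def IsIntSeries (h : PowerSeries ℚ) : Prop :=
  ∃ g : PowerSeries ℤ, PowerSeries.map (Int.castRingHom ℚ) g = h

/-- `h ∈ z ℤ[[z]]`. -/
def IsXMulIntSeries (h : PowerSeries ℚ) : Prop :=
  ∃ g : PowerSeries ℤ, PowerSeries.X * PowerSeries.map (Int.castRingHom ℚ) g = h

/-- `h ∈ ℤ_p[[z]]`, where `ℚ[[z]]` and `ℤ_p[[z]]` are both viewed inside `ℚ_p[[z]]`. -/
def IsPadicIntSeries (p : ℕ) [Fact p.Prime] (h : PowerSeries ℚ) : Prop :=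
  ∃ g : PowerSeries ℤ_[p],
    PowerSeries.map (algebraMap ℤ_[p] ℚ_[p]) g = PowerSeries.map (algebraMap ℚ ℚ_[p]) h

/-- `F` has constant term `1`, so that `F⁻¹` is its inverse. -/
theorem seriesF_mul_inv (e : Fin r → ℕ) (f : Fin s → ℕ) :
    seriesF e f * (seriesF e f)⁻¹ = 1 := by
  apply PowerSeries.mul_inv_cancel
  rw [← PowerSeries.coeff_zero_eq_constantCoeff_apply]
  simp [seriesF, factorialRatio]

/-- `G/F` has zero constant term, so that `exp(G/F)` is the usual composition. -/
theorem hasSubst_G (e : Fin r → ℕ) (f : Fin s → ℕ) :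
    PowerSeries.HasSubst (seriesG e f * (seriesF e f)⁻¹) := by
  apply PowerSeries.HasSubst.of_constantCoeff_zero'
  rw [map_mul, ← PowerSeries.coeff_zero_eq_constantCoeff_apply (seriesG e f)]
  simp [seriesG]

/-- `G_L/F` has zero constant term, so that `exp(G_L/F)` is the usual composition. -/
theorem hasSubst_GL (e : Fin r → ℕ) (f : Fin s → ℕ) (L : ℕ) :
    PowerSeries.HasSubst (seriesGL e f L * (seriesF e f)⁻¹) := by
  apply PowerSeries.HasSubst.of_constantCoeff_zero'
  rw [map_mul, ← PowerSeries.coeff_zero_eq_constantCoeff_apply (seriesGL e f L)]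
  simp [seriesGL]

end

end MirrorMap

/-! Integrality is tested one prime `p` at a time. Write `v` for the `p`-adic valuation and `Q`,
`F`, `G_L`, `Δ`, `M` as in the statement. Landau's criterion gives `Δ ≥ 0` (`landau_nonneg`), and
`Δ` takes integer values, which settles the dichotomy.

Case (i). By the Dieudonné-Dwork lemma, `exp h` is `p`-integral as soon as `h(z^p) - p h(z)` has
coefficients in `p ℤ_(p)`. For `h = G_L / F`, clearing the denominator `F(z) F(z^p)` turns this into
a congruence mod `p` for `∑_j Q(a + pj) Q(K - j) (H_{L(K-j)} - p H_{L(a+pj)})`. Replacing `p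
H_{L(a+pj)}` by `H_{Lj}` costs only a multiple of `p`, and leaves, up to sign, the sum of `H_{Lj}`
against terms antisymmetric under `j ↦ K - j`. Truncating the base-`p` digits of `j` telescopes
`H_{Lj}` into pieces constant on blocks of length `p^s`. Their denominators are compensated by
Dwork's formal congruences for block sums (`IsDworkSequence.dworkSum_mem`). All losses and gains are
measured by `bigCount`, the number of levels `l ≥ 1` where the fractional part of `n / p^l` is at
least `1/M`. By Legendre's formula and `Δ ≥ 1` on `[1/M, 1[` it bounds `v(Q(n))` from below.
Conversely, any power of `p` in a denominator forces a run of such levels with one level to spare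
(`bigRun_of_dvd`).

Case (ii). Let `Δ(x) = 0`, and for a large prime `p` put `a = ⌈xp⌉`, so that `⌊ca/p⌋ = ⌊cx⌋` for all
`c ≤ M` and `Q(a)` is a `p`-adic unit. If `q_L` is `p`-integral, so are the coefficients of `h = G_L
/ F` at indices prime to `p`. If `⌊Lx⌋ ≥ 1`, the coefficient of `G_L` at `a` then makes `p` divide
the numerator of `H_{⌊Lx⌋}`. If `⌊Lx⌋ = 0`, the coefficients at `p` and `a + p` give `P(1) ≡ P(0)
mod p`, where `P(u)` is the ratio of the `∏_{k ≤ ⌊e_i x⌋} (e_i u + k)` to the `∏_{k ≤ ⌊f_j x⌋} (f_j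
u + k)`. Either can hold for only finitely many `p`, since `H_{⌊Lx⌋} ≠ 0` and `P(1) ≠ P(0)`. The
latter inequality is an Abel summation of the jumps of `Δ` against a strictly decreasing logarithm
(`shiftRatio_one_ne_zero`).

Finally `q / z` is the quotient of `∏ q_{e_i}^{e_i}` by `∏ q_{f_j}^{f_j}`, and all these series have
constant term `1`. -/

namespace MirrorMap

/-! ### The `p`-adic filtration of `ℚ` -/

/-- The fractional ideal `p ^ k ℤ_(p)` of `ℚ`. -/
def padicIdeal (p : ℕ) [Fact p.Prime] (k : ℤ) : AddSubgroup ℚ where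
  carrier := {x | padicNorm p x ≤ (p : ℚ) ^ (-k)}
  zero_mem' := by simp only [Set.mem_ofPred_eq, padicNorm.zero]; positivity
  add_mem' := fun ha hb => padicNorm.nonarchimedean.trans (max_le ha hb)
  neg_mem' := fun ha => by simpa only [Set.mem_ofPred_eq, padicNorm.neg] using ha

/-- The group of `p`-adic units `x ∈ ℚ` with `x ≡ 1 mod p ^ k`, as a submonoid of `ℚ`. -/
def oneUnits (p : ℕ) [Fact p.Prime] (k : ℤ) : Submonoid ℚ where
  carrier := {x | x - 1 ∈ padicIdeal p k ∧ padicNorm p x = 1}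
  one_mem' := by simp
  mul_mem' := by
    rintro a b ⟨ha, ha'⟩ ⟨hb, hb'⟩
    refine ⟨?_, by rw [padicNorm.mul, ha', hb', one_mul]⟩
    have : a * b - 1 = a * (b - 1) + (a - 1) := by ring
    rw [this]
    refine add_mem ?_ ha
    change padicNorm p _ ≤ _
    rw [padicNorm.mul, ha', one_mul]
    exact hb

section

variable {p : ℕ} [hp : Fact p.Prime] {k l : ℤ} {x y : ℚ}

theorem mem_padicIdeal : x ∈ padicIdeal p k ↔ padicNorm p x ≤ (p : ℚ) ^ (-k) := Iff.rfl

theorem prime_pos_rat : (0 : ℚ) < p := by exact_mod_cast hp.out.pos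

theorem one_lt_prime_rat : (1 : ℚ) < p := by exact_mod_cast hp.out.one_lt

theorem padicIdeal_mul (hx : x ∈ padicIdeal p k) (hy : y ∈ padicIdeal p l) :
    x * y ∈ padicIdeal p (k + l) := by
  rw [mem_padicIdeal] at *
  rw [padicNorm.mul, neg_add, zpow_add₀ (prime_pos_rat (p := p)).ne']
  have := prime_pos_rat (p := p)
  exact mul_le_mul hx hy (padicNorm.nonneg _) (by positivity)

theorem padicIdeal_mono (h : l ≤ k) (hx : x ∈ padicIdeal p k) : x ∈ padicIdeal p l := by
  rw [mem_padicIdeal] at *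
  exact hx.trans (zpow_le_zpow_right₀ one_lt_prime_rat.le (by omega))

theorem padicIdeal_mul_of_le {m : ℤ} (hx : x ∈ padicIdeal p k) (hy : y ∈ padicIdeal p l)
    (h : m ≤ k + l) : x * y ∈ padicIdeal p m :=
  padicIdeal_mono h (padicIdeal_mul hx hy)

theorem padicIdeal_zero_iff : x ∈ padicIdeal p 0 ↔ padicNorm p x ≤ 1 := by
  simp [mem_padicIdeal]

theorem intCast_mem_padicIdeal (z : ℤ) : (z : ℚ) ∈ padicIdeal p 0 :=
  padicIdeal_zero_iff.2 (padicNorm.of_int z)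

theorem natCast_mem_padicIdeal (n : ℕ) : (n : ℚ) ∈ padicIdeal p 0 :=
  padicIdeal_zero_iff.2 (padicNorm.of_nat n)

theorem one_mem_padicIdeal : (1 : ℚ) ∈ padicIdeal p 0 := by
  exact_mod_cast natCast_mem_padicIdeal 1

theorem intCast_mem_padicIdeal_iff {t : ℕ} {z : ℤ} :
    (z : ℚ) ∈ padicIdeal p t ↔ (p : ℤ) ^ t ∣ z := by
  have := padicNorm.dvd_iff_norm_le (p := p) (n := t) (z := z)
  rw [mem_padicIdeal, ← this]
  simp

theorem natCast_mem_padicIdeal_iff {t n : ℕ} :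
    (n : ℚ) ∈ padicIdeal p t ↔ p ^ t ∣ n := by
  have := intCast_mem_padicIdeal_iff (p := p) (t := t) (z := n)
  rw [Int.cast_natCast] at this
  rw [this]
  exact_mod_cast Int.natCast_dvd_natCast

theorem prime_mem_padicIdeal : (p : ℚ) ∈ padicIdeal p 1 := by
  exact_mod_cast natCast_mem_padicIdeal_iff (p := p) (t := 1) (n := p).2 (by simp)

theorem padicNorm_inv (x : ℚ) : padicNorm p x⁻¹ = (padicNorm p x)⁻¹ := by
  rw [inv_eq_one_div, padicNorm.div, padicNorm.one, one_div]

theorem unit_mul_mem_iff (h : padicNorm p x = 1) :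
    x * y ∈ padicIdeal p k ↔ y ∈ padicIdeal p k := by
  rw [mem_padicIdeal, mem_padicIdeal, padicNorm.mul, h, one_mul]

theorem prime_mul_mem_iff : (p : ℚ) * x ∈ padicIdeal p (k + 1) ↔ x ∈ padicIdeal p k := by
  have h0 := prime_pos_rat (p := p)
  rw [mem_padicIdeal, mem_padicIdeal, padicNorm.mul, padicNorm.padicNorm_p_of_prime, neg_add,
    zpow_add₀ h0.ne', zpow_neg_one, mul_comm]
  exact mul_le_mul_iff_left₀ (by positivity)

theorem inv_natCast_mem_padicIdeal {n t : ℕ} (h : ¬ p ^ (t + 1) ∣ n) :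
    (n : ℚ)⁻¹ ∈ padicIdeal p (-t) := by
  have h0 := prime_pos_rat (p := p)
  have hn : (n : ℚ) ≠ 0 := by
    rintro h'
    have : n = 0 := by exact_mod_cast h'
    simp [this] at h
  rw [← natCast_mem_padicIdeal_iff, mem_padicIdeal, not_le] at h
  rw [mem_padicIdeal, padicNorm_inv]
  obtain ⟨z, hz⟩ := padicNorm.values_discrete (p := p) hn
  rw [hz] at h ⊢
  rw [zpow_lt_zpow_iff_right₀ one_lt_prime_rat] at h
  rw [← zpow_neg]
  refine zpow_le_zpow_right₀ one_lt_prime_rat.le ?_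
  push_cast at h
  omega

theorem oneUnits_mono (h : l ≤ k) (hx : x ∈ oneUnits p k) : x ∈ oneUnits p l :=
  ⟨padicIdeal_mono h hx.1, hx.2⟩

theorem oneUnits_ne_zero (hx : x ∈ oneUnits p k) : x ≠ 0 := by
  rintro rfl
  simpa using hx.2

theorem oneUnits_inv (hx : x ∈ oneUnits p k) : x⁻¹ ∈ oneUnits p k := by
  have h0 := oneUnits_ne_zero hx
  have h1 : padicNorm p x⁻¹ = 1 := by rw [padicNorm_inv, hx.2, inv_one]
  refine ⟨?_, h1⟩
  have : x⁻¹ - 1 = x⁻¹ * -(x - 1) := by field_simp; ring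
  rw [this, unit_mul_mem_iff h1]
  exact neg_mem hx.1

theorem oneUnits_div (hx : x ∈ oneUnits p k) (hy : y ∈ oneUnits p k) : x / y ∈ oneUnits p k := by
  rw [div_eq_mul_inv]
  exact mul_mem hx (oneUnits_inv hy)

/-- For `k ≥ 1` the unit condition is automatic by the ultrametric inequality. It is a genuine extra
condition only for `k ≤ 0`. -/
theorem mem_oneUnits_of_pos (hk : 1 ≤ k) (hx : x - 1 ∈ padicIdeal p k) : x ∈ oneUnits p k := by
  refine ⟨hx, ?_⟩
  have h1 : padicNorm p (x - 1) < 1 := by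
    refine lt_of_le_of_lt (mem_padicIdeal.1 hx) ?_
    rw [← zpow_zero (p : ℚ)]
    exact zpow_lt_zpow_right₀ one_lt_prime_rat (by omega)
  have h2 := padicNorm.add_eq_max_of_ne (p := p) (q := x - 1) (r := 1)
    (by rw [padicNorm.one]; exact h1.ne)
  rw [sub_add_cancel, padicNorm.one, max_eq_right h1.le] at h2
  exact h2

theorem padicNorm_prod {ι : Type*} (s : Finset ι) (g : ι → ℚ) :
    padicNorm p (∏ i ∈ s, g i) = ∏ i ∈ s, padicNorm p (g i) := by
  classical
  induction s using Finset.induction_on with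
  | empty => simp
  | insert a s ha ih => rw [Finset.prod_insert ha, Finset.prod_insert ha, padicNorm.mul, ih]

/-- A rational number which is `p`-integral for every prime `p` is an integer. -/
theorem exists_int_of_forall_padicIdeal (h : ∀ (p : ℕ) (_ : Fact p.Prime), x ∈ padicIdeal p 0) :
    ∃ z : ℤ, (z : ℚ) = x := by
  refine ⟨x.num, ?_⟩
  have hd : x.den = 1 := by
    by_contra hd
    obtain ⟨q, hq, hqd⟩ := Nat.exists_prime_and_dvd hd
    have : Fact q.Prime := ⟨hq⟩
    have h1 := h q this
    rw [padicIdeal_zero_iff] at h1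
    have h2 : padicNorm q (x * x.den) = padicNorm q x.num := by rw [Rat.mul_den_eq_num]
    have h3 : padicNorm q (x.num : ℚ) = 1 := by
      rw [padicNorm.int_eq_one_iff]
      intro h4
      have h5 : q ∣ x.num.natAbs := Int.natCast_dvd.1 h4
      exact hq.one_lt.ne' (Nat.dvd_one.1 (x.reduced.gcd_eq_one ▸ Nat.dvd_gcd h5 hqd))
    have h4 : padicNorm q (x.den : ℚ) < 1 := (padicNorm.nat_lt_one_iff _).2 hqd
    rw [padicNorm.mul, h3] at h2
    nlinarith [padicNorm.nonneg (p := q) x, padicNorm.nonneg (p := q) (x.den : ℚ)]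
  exact Rat.coe_int_num_of_den_eq_one hd

/-- A nonzero rational number is a unit at almost all primes. -/
theorem exists_forall_padicNorm_eq_one (hx : x ≠ 0) :
    ∃ N : ℕ, ∀ (p : ℕ) (_ : Fact p.Prime), N < p → padicNorm p x = 1 := by
  refine ⟨x.num.natAbs + x.den, fun p _ hp => ?_⟩
  have h1 : padicNorm p (x.num : ℚ) = 1 := by
    rw [padicNorm.int_eq_one_iff]
    intro h
    have := Nat.le_of_dvd (Int.natAbs_pos.2 (Rat.num_ne_zero.2 hx)) (Int.natCast_dvd.1 h)
    omega
  have h2 : padicNorm p (x.den : ℚ) = 1 := by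
    rw [padicNorm.nat_eq_one_iff]
    intro h
    have := Nat.le_of_dvd x.den_pos h
    omega
  rw [← Rat.num_div_den x, padicNorm.div, h1, h2, div_one]

end

/-! ### Splitting off the prime `p` from `Q(n)`; Legendre's formula -/

/-- The integer `Δ(n / q)`. -/
def floorDiff {r s : ℕ} (e : Fin r → ℕ) (f : Fin s → ℕ) (n q : ℕ) : ℤ :=
  ∑ i, ((e i * n / q : ℕ) : ℤ) - ∑ j, ((f j * n / q : ℕ) : ℤ)

/-- The product of the integers in `{1, …, N}` which are prime to `p`. -/
def unitFactorial (p N : ℕ) : ℕ := ∏ k ∈ Finset.range N, if p ∣ k + 1 then 1 else k + 1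

/-- The `p`-adic unit `∏ U(eᵢ n) / ∏ U(fⱼ n)`, where `U = unitFactorial p`. -/
def unitRatio (p : ℕ) {r s : ℕ} (e : Fin r → ℕ) (f : Fin s → ℕ) (n : ℕ) : ℚ :=
  (∏ i, (unitFactorial p (e i * n) : ℚ)) / ∏ j, (unitFactorial p (f j * n) : ℚ)

/-- The ratio `∏ᵢ ∏_{k = 1}^{Eᵢ} (eᵢ u + k) / ∏ⱼ ∏_{k = 1}^{Fⱼ} (fⱼ u + k)`. -/
def shiftRatio {r s : ℕ} (e : Fin r → ℕ) (f : Fin s → ℕ) (E : Fin r → ℕ) (F : Fin s → ℕ)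
    (u : ℕ) : ℚ :=
  (∏ i, ∏ k ∈ Finset.range (E i), ((e i * u + k + 1 : ℕ) : ℚ)) /
    ∏ j, ∏ k ∈ Finset.range (F j), ((f j * u + k + 1 : ℕ) : ℚ)

section

variable {p : ℕ} [hp : Fact p.Prime] {r s : ℕ} {e : Fin r → ℕ} {f : Fin s → ℕ}

theorem factorial_eq_unitFactorial (N : ℕ) :
    N ! = p ^ (N / p) * (N / p)! * unitFactorial p N := by
  induction N with
  | zero => simp [unitFactorial]
  | succ N ih =>
    rw [Nat.factorial_succ, ih, Nat.succ_div, unitFactorial, unitFactorial, Finset.prod_range_succ]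
    split_ifs with h
    · have h1 : N + 1 = p * (N / p + 1) := by
        have := Nat.div_mul_cancel h
        rw [Nat.succ_div, if_pos h] at this
        rw [mul_comm]; exact this.symm
      rw [Nat.factorial_succ, pow_succ]
      nth_rw 1 [h1]
      ring
    · rw [add_zero]; ring

theorem padicNorm_unitFactorial (N : ℕ) : padicNorm p (unitFactorial p N) = 1 := by
  rw [unitFactorial, Nat.cast_prod, padicNorm_prod]
  refine Finset.prod_eq_one fun k _ => ?_
  split_ifs with h
  · simp
  · exact (padicNorm.nat_eq_one_iff _).2 h

theorem unitFactorial_ne_zero (N : ℕ) : (unitFactorial p N : ℚ) ≠ 0 := by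
  intro h
  simpa [h] using padicNorm_unitFactorial (p := p) N

/-- Moving the endpoint by `p ^ (t + 1)` adds one full period of residues prime to `p`. Wilson's
evaluation of that period as `±1` is not needed: it cancels in `unitRatio_add_div`. -/
theorem unitFactorial_add_modEq (N t : ℕ) :
    unitFactorial p (N + p ^ (t + 1)) ≡ unitFactorial p N * unitFactorial p (p ^ (t + 1))
      [MOD p ^ (t + 1)] := by
  induction N with
  | zero => simp [unitFactorial]; rfl
  | succ N ih =>
    have h1 : N + 1 + p ^ (t + 1) = N + p ^ (t + 1) + 1 := by ring
    rw [h1, unitFactorial, Finset.prod_range_succ]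
    have h2 : unitFactorial p (N + 1) = unitFactorial p N * if p ∣ N + 1 then 1 else N + 1 := by
      rw [unitFactorial, Finset.prod_range_succ]; rfl
    rw [h2, mul_right_comm]
    refine Nat.ModEq.mul ih ?_
    have h3 : p ∣ N + p ^ (t + 1) + 1 ↔ p ∣ N + 1 := by
      rw [← h1]
      exact Nat.dvd_add_left (dvd_pow_self p (Nat.succ_ne_zero t))
    simp only [h3]
    split_ifs
    · rfl
    · rw [← h1]
      simp [Nat.ModEq]

theorem div_mem_oneUnits_of_modEq {a b t : ℕ} (h : a ≡ b [MOD p ^ t]) (ha : padicNorm p a = 1)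
    (hb : padicNorm p b = 1) : (a : ℚ) / b ∈ oneUnits p t := by
  have hb0 : (b : ℚ) ≠ 0 := by rintro h; simp [h] at hb
  refine ⟨?_, by rw [padicNorm.div, ha, hb, div_one]⟩
  have h1 : (a : ℚ) / b - 1 = (b : ℚ)⁻¹ * ((a - b : ℤ) : ℚ) := by
    push_cast
    field_simp
  rw [h1, unit_mul_mem_iff (by rw [padicNorm_inv, hb, inv_one]), intCast_mem_padicIdeal_iff]
  have := (Nat.modEq_iff_dvd.1 h.symm)
  exact_mod_cast this

theorem unitFactorial_add_mul (N t c : ℕ) :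
    (unitFactorial p (N + c * p ^ (t + 1)) : ℚ) /
      (unitFactorial p N * (unitFactorial p (p ^ (t + 1)) : ℚ) ^ c) ∈ oneUnits p (t + 1 : ℕ) := by
  induction c with
  | zero => simp [div_self (unitFactorial_ne_zero (p := p) N)]
  | succ c ih =>
    have h1 : N + (c + 1) * p ^ (t + 1) = N + c * p ^ (t + 1) + p ^ (t + 1) := by ring
    have h2 := div_mem_oneUnits_of_modEq (unitFactorial_add_modEq (p := p) (N + c * p ^ (t + 1)) t)
      (padicNorm_unitFactorial _)
      (by rw [Nat.cast_mul, padicNorm.mul, padicNorm_unitFactorial, padicNorm_unitFactorial, one_mul])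
    have h3 := mul_mem h2 ih
    rw [h1]
    convert h3 using 1
    have := unitFactorial_ne_zero (p := p) N
    have := unitFactorial_ne_zero (p := p) (N + c * p ^ (t + 1))
    have := unitFactorial_ne_zero (p := p) (p ^ (t + 1))
    push_cast
    field_simp
    ring

theorem padicNorm_unitRatio (n : ℕ) : padicNorm p (unitRatio p e f n) = 1 := by
  simp [unitRatio, padicNorm.div, padicNorm_prod, padicNorm_unitFactorial]

theorem unitRatio_ne_zero (n : ℕ) : unitRatio p e f n ≠ 0 := by
  intro h
  simpa [h] using padicNorm_unitRatio (p := p) (e := e) (f := f) n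

/-- Each `c` among the `e i` and `f j` contributes `w ^ (c * m)`, with `w` the product over one
period. These powers cancel between numerator and denominator because the two sums agree. -/
theorem unitRatio_add_div (hsum : ∑ i, e i = ∑ j, f j) (n m t : ℕ) :
    unitRatio p e f (n + m * p ^ (t + 1)) / unitRatio p e f n ∈ oneUnits p (t + 1 : ℕ) := by
  set w : ℚ := (unitFactorial p (p ^ (t + 1)) : ℚ) with hw
  have hw0 : w ≠ 0 := unitFactorial_ne_zero _
  have key : ∀ {a : ℕ} (c : Fin a → ℕ),
      (∏ i, (unitFactorial p (c i * (n + m * p ^ (t + 1))) : ℚ)) /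
        ((∏ i, (unitFactorial p (c i * n) : ℚ)) * w ^ ((∑ i, c i) * m)) ∈
        oneUnits p (t + 1 : ℕ) := by
    intro a c
    have h1 : (∏ i, (unitFactorial p (c i * (n + m * p ^ (t + 1))) : ℚ)) /
        ((∏ i, (unitFactorial p (c i * n) : ℚ)) * w ^ ((∑ i, c i) * m)) =
        ∏ i, ((unitFactorial p (c i * n + c i * m * p ^ (t + 1)) : ℚ) /
          (unitFactorial p (c i * n) * w ^ (c i * m))) := by
      rw [Finset.prod_div_distrib, Finset.prod_mul_distrib, Finset.prod_pow_eq_pow_sum,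
        Finset.sum_mul]
      simp only [mul_add, mul_assoc]
    rw [h1]
    exact Submonoid.prod_mem _ fun i _ => unitFactorial_add_mul _ _ _
  have h := oneUnits_div (key e) (key f)
  convert h using 1
  have hne : ∀ {a : ℕ} (c : Fin a → ℕ) (N : ℕ), (∏ i, (unitFactorial p (c i * N) : ℚ)) ≠ 0 :=
    fun c N => Finset.prod_ne_zero_iff.2 fun i _ => unitFactorial_ne_zero _
  have := hne e n
  have := hne f n
  have := hne f (n + m * p ^ (t + 1))
  rw [unitRatio, unitRatio, hsum]
  field_simp

theorem shiftRatio_ne_zero {E : Fin r → ℕ} {F : Fin s → ℕ} (u : ℕ) :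
    shiftRatio e f E F u ≠ 0 := by
  refine div_ne_zero ?_ ?_ <;>
  exact Finset.prod_ne_zero_iff.2 fun i _ => Finset.prod_ne_zero_iff.2 fun k _ => by positivity

theorem factorialRatio_ne_zero (n : ℕ) : factorialRatio e f n ≠ 0 := by
  refine div_ne_zero ?_ ?_ <;>
  exact Finset.prod_ne_zero_iff.2 fun i _ => by positivity

theorem factorial_mul_add (c u v : ℕ) :
    ((c * (v + p * u))! : ℚ) = (p : ℚ) ^ (c * u + c * v / p) * ((c * u)! *
      ∏ k ∈ Finset.range (c * v / p), ((c * u + k + 1 : ℕ) : ℚ)) *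
      unitFactorial p (c * (v + p * u)) := by
  have h1 : c * (v + p * u) / p = c * u + c * v / p := by
    rw [mul_add, mul_left_comm, Nat.add_mul_div_left _ _ hp.out.pos, add_comm]
  have h2 : (c * u + c * v / p)! = (c * u)! * ∏ k ∈ Finset.range (c * v / p), (c * u + k + 1) := by
    rw [← Nat.factorial_mul_ascFactorial, Nat.ascFactorial_eq_prod_range]
    congr 1
    exact Finset.prod_congr rfl fun k _ => by ring
  rw [factorial_eq_unitFactorial (p := p) (c * (v + p * u)), h1, h2]
  push_cast
  ring

/-- Among the factors of `(c (v + p u))!`, the multiples of `p` give a power of `p` times `(c u + ⌊c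
v / p⌋)!`. The latter is `(c u)!` extended by the factors collected in `shiftRatio`. The powers `p ^
(c u)` cancel since the sums agree. -/
theorem factorialRatio_add_mul (hsum : ∑ i, e i = ∑ j, f j) (u v : ℕ) :
    factorialRatio e f (v + p * u) = factorialRatio e f u * unitRatio p e f (v + p * u) *
      (p : ℚ) ^ floorDiff e f v p *
      shiftRatio e f (fun i => e i * v / p) (fun j => f j * v / p) u := by
  have hp0 := (prime_pos_rat (p := p)).ne'
  have h1 : (p : ℚ) ^ floorDiff e f v p = (∏ i, (p : ℚ) ^ (e i * u + e i * v / p)) /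
      ∏ j, (p : ℚ) ^ (f j * u + f j * v / p) := by
    rw [Finset.prod_pow_eq_pow_sum, Finset.prod_pow_eq_pow_sum, ← zpow_natCast, ← zpow_natCast,
      ← zpow_sub₀ hp0, Finset.sum_add_distrib, Finset.sum_add_distrib, ← Finset.sum_mul,
      ← Finset.sum_mul, hsum, floorDiff]
    congr 1
    push_cast
    ring
  rw [h1]
  simp only [factorialRatio, unitRatio, shiftRatio, factorial_mul_add, Finset.prod_mul_distrib]
  rw [div_mul_div_comm, div_mul_div_comm, div_mul_div_comm]
  congr 1 <;> ring

theorem factorialRatio_zero : factorialRatio e f 0 = 1 := by simp [factorialRatio]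

theorem le_maxTerm_left (i : Fin r) : e i ≤ maxTerm e f :=
  le_max_of_le_left (Finset.le_sup (f := e) (Finset.mem_univ i))

theorem le_maxTerm_right (j : Fin s) : f j ≤ maxTerm e f :=
  le_max_of_le_right (Finset.le_sup (f := f) (Finset.mem_univ j))

theorem padicNorm_factorial {N b : ℕ} (h : N < p ^ b) (hb : 0 < b) :
    padicNorm p (N ! : ℚ) = (p : ℚ) ^ (-∑ l ∈ Finset.Ico 1 b, ((N / p ^ l : ℕ) : ℤ)) := by
  have hlog : Nat.log p N < b := by
    rcases eq_or_ne N 0 with rfl | hN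
    · simpa using hb
    · exact Nat.log_lt_of_lt_pow hN h
  rw [padicNorm.eq_zpow_of_nonzero (by positivity), padicValRat.of_nat, padicValNat_factorial hlog]
  push_cast
  rfl

/-- Legendre's formula for `Q(n)`. -/
theorem padicNorm_factorialRatio {n b : ℕ} (h : maxTerm e f * n < p ^ b) (hb : 0 < b) :
    padicNorm p (factorialRatio e f n) =
      (p : ℚ) ^ (-∑ l ∈ Finset.Ico 1 b, floorDiff e f n (p ^ l)) := by
  have hp0 := (prime_pos_rat (p := p)).ne'
  have key : ∀ {a : ℕ} (c : Fin a → ℕ), (∀ i, c i ≤ maxTerm e f) →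
      padicNorm p (∏ i, ((c i * n)! : ℚ)) =
        (p : ℚ) ^ (-∑ l ∈ Finset.Ico 1 b, ∑ i, ((c i * n / p ^ l : ℕ) : ℤ)) := by
    intro a c hc
    rw [padicNorm_prod, Finset.sum_comm, ← Finset.sum_neg_distrib]
    have : ∀ g : Fin a → ℤ, (p : ℚ) ^ (∑ i, g i) = ∏ i, (p : ℚ) ^ g i := by
      intro g
      induction (Finset.univ : Finset (Fin a)) using Finset.induction_on with
      | empty => simp
      | insert x t hx ih => rw [Finset.sum_insert hx, Finset.prod_insert hx, zpow_add₀ hp0, ih]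
    rw [this]
    refine Finset.prod_congr rfl fun i _ => padicNorm_factorial (lt_of_le_of_lt ?_ h) hb
    exact Nat.mul_le_mul_right _ (hc i)
  rw [factorialRatio, padicNorm.div, key e fun i => le_maxTerm_left i,
    key f fun j => le_maxTerm_right j, ← zpow_sub₀ hp0]
  simp only [floorDiff, Finset.sum_sub_distrib]
  congr 1
  ring

/-- `Δ` has period `1` because `∑ e = ∑ f`. -/
theorem floorDiff_mod (hsum : ∑ i, e i = ∑ j, f j) (n q : ℕ) (hq : 0 < q) :
    floorDiff e f n q = floorDiff e f (n % q) q := by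
  have key : ∀ c : ℕ, ((c * n / q : ℕ) : ℤ) = ((c * (n % q) / q : ℕ) : ℤ) + c * (n / q : ℕ) := by
    intro c
    have : c * n = c * (n % q) + q * (c * (n / q)) := by
      conv_lhs => rw [← Nat.mod_add_div n q]
      ring
    rw [this, Nat.add_mul_div_left _ _ hq]
    push_cast
    ring
  have hsum' : ∑ i, (e i : ℤ) = ∑ j, (f j : ℤ) := by exact_mod_cast hsum
  simp only [floorDiff, key, Finset.sum_add_distrib, ← Finset.sum_mul, hsum']
  ring

theorem floorDiff_eq_zero_of_lt {n q : ℕ} (h : maxTerm e f * n < q) : floorDiff e f n q = 0 := by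
  have key : ∀ c ≤ maxTerm e f, c * n / q = 0 := fun c hc =>
    Nat.div_eq_of_lt (lt_of_le_of_lt (Nat.mul_le_mul_right _ hc) h)
  simp [floorDiff, key _ (le_maxTerm_left _), key _ (le_maxTerm_right _)]

end

/-! ### Levels with large fractional part; Dwork sequences and block sums -/

/-- The levels `l ≥ 1` such that the fractional part of `n / p ^ l` is at least `1 / M`. -/
def bigLevels (M p n : ℕ) : Finset ℕ :=
  (Finset.Icc 1 (M * n)).filter fun l => p ^ l ≤ M * (n % p ^ l)

/-- The number of levels in `bigLevels`. -/
def bigCount (M p n : ℕ) : ℕ := (bigLevels M p n).card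

/-- All the levels `1, …, t` belong to `bigLevels M p n`. -/
def BigRun (M p n t : ℕ) : Prop := ∀ l, 1 ≤ l → l ≤ t → p ^ l ≤ M * (n % p ^ l)

/-- The hypotheses of the formal congruence theorem. -/
structure IsDworkSequence (p : ℕ) [Fact p.Prime] (M : ℕ) (A : ℕ → ℚ) : Prop where
  zero : A 0 = 1
  mem : ∀ n, A n ∈ padicIdeal p (bigCount M p n)
  div_mem : ∀ s u m, M * u < p ^ s → A (u + m * p ^ s) / A u ∈ padicIdeal p (bigCount M p m)
  ne_zero : ∀ n, A n ≠ 0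
  congr : ∀ s u v m, v < p → M * u < p ^ s → ¬ BigRun M p (v + p * u) (s + 1) →
    A (v + p * u + m * p ^ (s + 1)) / A (v + p * u) - A (u + m * p ^ s) / A u ∈
      padicIdeal p (s + 1 + bigCount M p m - bigCount M p (v + p * u))

/-- The antisymmetrised product `A(a + jp) A(K - j) - A(j) A(a + (K - j)p)`. -/
def dworkTerm (p : ℕ) (A : ℕ → ℚ) (a K j : ℕ) : ℚ :=
  if j ≤ K then A (a + p * j) * A (K - j) - A j * A (a + p * (K - j)) else 0

/-- The sum of `dworkTerm` over the block `[m p ^ s, (m + 1) p ^ s)`. -/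
def dworkSum (p : ℕ) (A : ℕ → ℚ) (a K s m : ℕ) : ℚ :=
  ∑ j ∈ Finset.range (p ^ s), dworkTerm p A a K (j + m * p ^ s)

/-- The sum of `g` over the integers `j < p ^ t` with `j / p ^ t < 1 / M`. -/
def smallSum (p M t : ℕ) (g : ℕ → ℚ) : ℚ :=
  ∑ j ∈ Finset.range (p ^ t), if M * j < p ^ t then g j else 0

theorem sum_range_mul (b c : ℕ) (g : ℕ → ℚ) :
    ∑ j ∈ Finset.range (c * b), g j =
      ∑ n ∈ Finset.range c, ∑ i ∈ Finset.range b, g (i + n * b) := by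
  induction c with
  | zero => simp
  | succ c ih =>
    rw [Finset.sum_range_succ, ← ih, add_mul, one_mul, Finset.sum_range_add]
    simp only [add_comm]

section

variable {p : ℕ} [hp : Fact p.Prime] {M : ℕ}

theorem mem_bigLevels {n l : ℕ} :
    l ∈ bigLevels M p n ↔ 1 ≤ l ∧ p ^ l ≤ M * (n % p ^ l) := by
  rw [bigLevels, Finset.mem_filter, Finset.mem_Icc]
  refine ⟨fun h => ⟨h.1.1, h.2⟩, fun h => ⟨⟨h.1, ?_⟩, h.2⟩⟩
  have h1 : l < p ^ l := Nat.lt_pow_self hp.out.one_lt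
  have h2 : M * (n % p ^ l) ≤ M * n := Nat.mul_le_mul_left _ (Nat.mod_le _ _)
  omega

/-- Restoring the `t` low digits of `N` can only increase the fractional part at level `t + l`. -/
theorem add_mem_bigLevels {N t l : ℕ} (h : l ∈ bigLevels M p (N / p ^ t)) :
    t + l ∈ bigLevels M p N := by
  rw [mem_bigLevels] at *
  refine ⟨by omega, ?_⟩
  rw [pow_add, Nat.mod_mul]
  calc p ^ t * p ^ l ≤ p ^ t * (M * (N / p ^ t % p ^ l)) := Nat.mul_le_mul_left _ h.2
    _ = M * (p ^ t * (N / p ^ t % p ^ l)) := by ring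
    _ ≤ _ := Nat.mul_le_mul_left _ (Nat.le_add_left _ _)

theorem BigRun.add_bigCount_le {N t : ℕ} (h : BigRun M p N t) :
    t + bigCount M p (N / p ^ t) ≤ bigCount M p N := by
  have h1 : (Finset.Icc 1 t).card + (bigLevels M p (N / p ^ t)).card =
      (Finset.Icc 1 t ∪ (bigLevels M p (N / p ^ t)).map (addLeftEmbedding t)).card := by
    rw [Finset.card_union_of_disjoint, Finset.card_map]
    rw [Finset.disjoint_left]
    intro l hl hl'
    rw [Finset.mem_map] at hl'
    obtain ⟨l', hl', rfl⟩ := hl'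
    rw [mem_bigLevels] at hl'
    rw [addLeftEmbedding_apply, Finset.mem_Icc] at hl
    omega
  rw [Nat.card_Icc, Nat.add_sub_cancel] at h1
  rw [bigCount, bigCount, h1]
  refine Finset.card_le_card (Finset.union_subset ?_ ?_)
  · intro l hl
    rw [Finset.mem_Icc] at hl
    exact mem_bigLevels.2 ⟨hl.1, h l hl.1 hl.2⟩
  · intro l hl
    rw [Finset.mem_map] at hl
    obtain ⟨l', hl', rfl⟩ := hl
    exact add_mem_bigLevels hl'

theorem BigRun.le_bigCount {N t : ℕ} (h : BigRun M p N t) : t ≤ bigCount M p N :=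
  (Nat.le_add_right _ _).trans h.add_bigCount_le

theorem BigRun.add_mul {n t m : ℕ} (h : BigRun M p n t) : BigRun M p (n + m * p ^ t) t := by
  intro l h1 h2
  have h3 : (n + m * p ^ t) % p ^ l = n % p ^ l := by
    obtain ⟨d, rfl⟩ := Nat.exists_eq_add_of_le h2
    rw [pow_add, mul_left_comm, Nat.add_mul_mod_self_left]
  rw [h3]
  exact h l h1 h2

/-- An integer that is not small although its quotient by `p` is small. Above level `l` the high
digits alone stay strictly below the bound, hence fall short by at least one unit, and the residue
mod `p ^ l` must make up the difference. -/
theorem bigRun_of_minimal {n t : ℕ} (h1 : p ^ (t + 1) ≤ M * n) (h2 : M * (n / p) < p ^ t) :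
    BigRun M p n (t + 1) := by
  intro l hl hl'
  obtain ⟨l, rfl⟩ := Nat.exists_eq_add_of_le' hl
  obtain ⟨d, rfl⟩ := Nat.exists_eq_add_of_le (Nat.le_of_succ_le_succ hl')
  have h3 : M * (n / p ^ (l + 1)) < p ^ d := by
    have h4 : n / p ^ (l + 1) = n / p / p ^ l := by rw [Nat.div_div_eq_div_mul, pow_succ']
    have h5 : p ^ l * (M * (n / p ^ (l + 1))) < p ^ l * p ^ d := by
      rw [h4, ← pow_add]
      refine lt_of_le_of_lt ?_ h2
      rw [mul_left_comm]
      exact Nat.mul_le_mul_left _ (Nat.mul_div_le _ _)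
    exact lt_of_mul_lt_mul_left h5 (Nat.zero_le _)
  have h6 : M * n = M * (n % p ^ (l + 1)) + p ^ (l + 1) * (M * (n / p ^ (l + 1))) := by
    conv_lhs => rw [← Nat.mod_add_div n (p ^ (l + 1))]
    ring
  have h7 : p ^ (l + 1) * (M * (n / p ^ (l + 1)) + 1) ≤ p ^ (l + 1) * p ^ d :=
    Nat.mul_le_mul_left _ h3
  rw [← pow_add] at h7
  have h8 : l + 1 + d = l + d + 1 := by ring
  rw [h8] at h7
  rw [mul_add, mul_one] at h7
  omega

/-- Reducing `j` mod `p ^ l` keeps the divisibility, so `p ^ l ≤ c (j mod p ^ l) + k`. Multiplying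
by `p` and using `p k ≤ c a` gives the bound at level `l + 1`. A factor `p ^ w` thus yields `w + 1`
levels, and this extra level is the source of every gain of one power of `p` below. -/
theorem bigRun_of_dvd {c a j k w : ℕ} (hc : c ≤ M) (ha : a < p) (hk : 1 ≤ k) (hk' : k ≤ c * a / p)
    (hw : p ^ w ∣ c * j + k) : BigRun M p (a + p * j) (w + 1) := by
  intro l hl hl'
  obtain ⟨l, rfl⟩ := Nat.exists_eq_add_of_le' hl
  have h1 : p ^ l ∣ c * (j % p ^ l) + k := by
    have h2 := (pow_dvd_pow p (Nat.le_of_succ_le_succ hl')).trans hw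
    have h3 : c * j + k = c * (j % p ^ l) + k + p ^ l * (c * (j / p ^ l)) := by
      conv_lhs => rw [← Nat.mod_add_div j (p ^ l)]
      ring
    rw [h3] at h2
    exact (Nat.dvd_add_left (dvd_mul_right _ _)).1 h2
  have h4 : p ^ l ≤ c * (j % p ^ l) + k := Nat.le_of_dvd (by omega) h1
  have h5 : (a + p * j) % p ^ (l + 1) = a + p * (j % p ^ l) := by
    rw [pow_succ', Nat.mod_mul, Nat.add_mul_mod_self_left, Nat.mod_eq_of_lt ha,
      Nat.add_mul_div_left _ _ hp.out.pos, Nat.div_eq_of_lt ha, zero_add]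
  have h6 : p * k ≤ c * a := (Nat.mul_le_mul_left p hk').trans (Nat.mul_div_le _ _)
  rw [h5]
  calc p ^ (l + 1) = p * p ^ l := pow_succ' _ _
    _ ≤ p * (c * (j % p ^ l) + k) := Nat.mul_le_mul_left _ h4
    _ = c * (p * (j % p ^ l)) + p * k := by ring
    _ ≤ c * (p * (j % p ^ l)) + c * a := by omega
    _ = c * (a + p * (j % p ^ l)) := by ring
    _ ≤ _ := Nat.mul_le_mul_right _ hc

/-- Reveals one more base-`p` digit. Integers whose quotient is not small are not small themselves.
Those with small quotient either remain small, where `g` is exchanged for `h`, or have just ceased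
to be small, where `g` itself is negligible. -/
theorem smallSum_step {I : AddSubgroup ℚ} {t : ℕ} {g h : ℕ → ℚ}
    (good : ∀ u v, u < p ^ t → v < p → M * u < p ^ t → M * (v + p * u) < p ^ (t + 1) →
      g (v + p * u) - h (v + p * u) ∈ I)
    (bad : ∀ u v, u < p ^ t → v < p → M * u < p ^ t → p ^ (t + 1) ≤ M * (v + p * u) →
      g (v + p * u) ∈ I) :
    smallSum p M t (fun u => ∑ v ∈ Finset.range p, g (v + p * u)) - smallSum p M (t + 1) h ∈ I := by
  rw [smallSum, smallSum, pow_succ, sum_range_mul, ← Finset.sum_sub_distrib]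
  refine sum_mem fun u hu => ?_
  rw [Finset.mem_range] at hu
  have h1 : (if M * u < p ^ t then ∑ v ∈ Finset.range p, g (v + p * u) else 0) =
      ∑ v ∈ Finset.range p, if M * u < p ^ t then g (v + p * u) else 0 := by
    split_ifs <;> simp
  rw [h1, ← Finset.sum_sub_distrib]
  refine sum_mem fun v hv => ?_
  rw [Finset.mem_range] at hv
  rw [mul_comm u p, ← pow_succ]
  by_cases h2 : M * u < p ^ t
  · rw [if_pos h2]
    by_cases h3 : M * (v + p * u) < p ^ (t + 1)
    · rw [if_pos h3]
      exact good u v hu hv h2 h3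
    · rw [if_neg h3, sub_zero]
      exact bad u v hu hv h2 (not_lt.1 h3)
  · have h3 : ¬ M * (v + p * u) < p ^ (t + 1) := by
      intro h3
      apply h2
      have : p * (M * u) < p * p ^ t := by
        rw [← pow_succ']
        refine lt_of_le_of_lt ?_ h3
        rw [mul_left_comm]
        exact Nat.mul_le_mul_left _ (Nat.le_add_left _ _)
      exact lt_of_mul_lt_mul_left this (Nat.zero_le _)
    rw [if_neg h2, if_neg h3, sub_zero]
    exact I.zero_mem

variable {A : ℕ → ℚ} {a : ℕ}

theorem dworkSum_zero (K m : ℕ) : dworkSum p A a K 0 m = dworkTerm p A a K m := by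
  simp [dworkSum]

theorem dworkSum_succ (K s m : ℕ) :
    dworkSum p A a K (s + 1) m = ∑ v ∈ Finset.range p, dworkSum p A a K s (v + p * m) := by
  rw [dworkSum, pow_succ', sum_range_mul]
  refine Finset.sum_congr rfl fun v _ => Finset.sum_congr rfl fun i _ => ?_
  congr 1
  ring

theorem dworkSum_eq_zero {K s m : ℕ} (h : K < m * p ^ s) : dworkSum p A a K s m = 0 := by
  refine Finset.sum_eq_zero fun j _ => ?_
  rw [dworkTerm, if_neg (by omega)]

/-- `dworkTerm` changes sign under `j ↦ K - j`. -/
theorem sum_dworkSum_eq_zero (K s c : ℕ) (hc : K < c * p ^ s) :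
    ∑ m ∈ Finset.range c, dworkSum p A a K s m = 0 := by
  simp only [dworkSum]
  rw [← sum_range_mul, ← Finset.sum_subset (s₁ := Finset.range (K + 1))]
  · have h1 : ∑ j ∈ Finset.range (K + 1), dworkTerm p A a K j =
        -∑ j ∈ Finset.range (K + 1), dworkTerm p A a K j := by
      rw [← Finset.sum_neg_distrib]
      conv_lhs => rw [← Finset.sum_range_reflect]
      refine Finset.sum_congr rfl fun j hj => ?_
      rw [Finset.mem_range] at hj
      have h2 : K + 1 - 1 - j = K - j := by omega
      rw [h2, dworkTerm, dworkTerm, if_pos (by omega), if_pos (by omega)]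
      have h3 : K - (K - j) = j := by omega
      rw [h3]
      ring
    linarith
  · intro j hj
    rw [Finset.mem_range] at *
    omega
  · intro j _ hj
    rw [Finset.mem_range] at hj
    rw [dworkTerm, if_neg (by omega)]

theorem IsDworkSequence.mem_zero (hA : IsDworkSequence p M A) (n : ℕ) : A n ∈ padicIdeal p 0 :=
  padicIdeal_mono (by positivity) (hA.mem n)

end

/-! ### Formal congruences for block sums -/

section

variable {p : ℕ} [hp : Fact p.Prime] {M : ℕ} {A : ℕ → ℚ} {a : ℕ}

/-- Translating `K` and `j` together fixes `K - j`, so the terms containing `A (a + p * (K - j))`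
cancel and a single difference of values of `A` remains. -/
theorem IsDworkSequence.dworkTerm_sub_mem (hA : IsDworkSequence p M A) (ha : a < p) {s j : ℕ}
    (hj : M * j < p ^ s) (K m : ℕ) :
    dworkTerm p A a (K + m * p ^ s) (j + m * p ^ s) -
      A (j + m * p ^ s) / A j * dworkTerm p A a K j ∈ padicIdeal p (s + 1 + bigCount M p m) := by
  rw [dworkTerm, dworkTerm]
  by_cases hjK : j ≤ K
  swap
  · rw [if_neg (by omega), if_neg hjK, mul_zero, sub_zero]
    exact AddSubgroup.zero_mem _
  rw [if_pos (by omega), if_pos hjK]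
  have h1 : K + m * p ^ s - (j + m * p ^ s) = K - j := by omega
  have h2 : a + p * (j + m * p ^ s) = a + p * j + m * p ^ (s + 1) := by ring
  have hj0 := hA.ne_zero j
  rw [h1, h2]
  have h3 : A (a + p * j + m * p ^ (s + 1)) * A (K - j) - A (j + m * p ^ s) * A (a + p * (K - j)) -
      A (j + m * p ^ s) / A j * (A (a + p * j) * A (K - j) - A j * A (a + p * (K - j))) =
      A (K - j) * (A (a + p * j + m * p ^ (s + 1)) -
        A (j + m * p ^ s) / A j * A (a + p * j)) := by
    field_simp
    ring
  rw [h3]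
  refine padicIdeal_mul_of_le (hA.mem_zero _) ?_ (zero_add _).ge
  -- With a run through level `s + 1` each of the two terms is already divisible enough. Otherwise
  -- the `congr` axiom applies, its loss `bigCount M p (a + p * j)` being repaid by the factor `A (a
  -- + p * j)`.
  by_cases hrun : BigRun M p (a + p * j) (s + 1)
  · refine sub_mem ?_ ?_
    · refine padicIdeal_mono ?_ (hA.mem _)
      have h4 := (hrun.add_mul (m := m)).add_bigCount_le
      have h5 : bigCount M p m ≤ bigCount M p ((a + p * j + m * p ^ (s + 1)) / p ^ (s + 1)) := by
        rw [Nat.add_mul_div_right _ _ (pow_pos hp.out.pos _)]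
        rcases Nat.eq_zero_or_pos ((a + p * j) / p ^ (s + 1)) with h6 | h6
        · rw [h6, zero_add]
        · exfalso
          have h7 : p ^ (s + 1) ≤ a + p * j := Nat.le_of_not_lt fun h =>
            h6.ne' (Nat.div_eq_of_lt h)
          have h8 : p ^ s ≤ j := by
            have : p * p ^ s < p * (j + 1) := by
              rw [← pow_succ', mul_add]; omega
            have := lt_of_mul_lt_mul_left this (Nat.zero_le _)
            omega
          have h9 := hrun 1 le_rfl (by omega)
          have hM : 0 < M := by
            rcases Nat.eq_zero_or_pos M with rfl | h
            · have := hp.out.pos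
              simp at h9
              omega
            · exact h
          have := Nat.mul_le_mul hM h8
          omega
      omega
    · refine padicIdeal_mul_of_le (hA.div_mem s j m hj) (hA.mem _) ?_
      have := hrun.le_bigCount
      omega
  · have h4 := padicIdeal_mul (hA.mem (a + p * j)) (hA.congr s j a m ha hj hrun)
    have h0 := hA.ne_zero (a + p * j)
    have h5 : A (a + p * j + m * p ^ (s + 1)) - A (j + m * p ^ s) / A j * A (a + p * j) =
        A (a + p * j) * (A (a + p * j + m * p ^ (s + 1)) / A (a + p * j) -
          A (j + m * p ^ s) / A j) := by
      field_simp
    rw [h5]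
    exact padicIdeal_mono (by omega) h4

/-- Blocks which do not contain small integers contribute little. -/
theorem dworkSum_sub_smallSum_mem {s : ℕ}
    (ih : ∀ s' < s, ∀ K m, dworkSum p A a K s' m ∈ padicIdeal p (s' + 1 + bigCount M p m))
    (K m t : ℕ) (ht : t ≤ s) :
    dworkSum p A a K s m - smallSum p M t (fun n => dworkSum p A a K (s - t) (n + m * p ^ t)) ∈
      padicIdeal p (s + 1 + bigCount M p m) := by
  induction t with
  | zero => simp [smallSum]
  | succ t iht =>
    have h1 := iht (by omega)
    have h2 : ∀ n, dworkSum p A a K (s - t) (n + m * p ^ t) = ∑ v ∈ Finset.range p,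
        dworkSum p A a K (s - (t + 1)) (v + p * n + m * p ^ (t + 1)) := by
      intro n
      have h3 : s - t = s - (t + 1) + 1 := by omega
      rw [h3, dworkSum_succ]
      refine Finset.sum_congr rfl fun v _ => ?_
      congr 1
      ring
    simp only [h2] at h1
    have h3 := smallSum_step (p := p) (M := M) (I := padicIdeal p (s + 1 + bigCount M p m)) (t := t)
      (g := fun j => dworkSum p A a K (s - (t + 1)) (j + m * p ^ (t + 1)))
      (h := fun j => dworkSum p A a K (s - (t + 1)) (j + m * p ^ (t + 1)))
      (fun u v _ _ _ _ => by simp)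
      -- An integer that has just left the small range has a run of length `t + 1`. This compensates
      -- exactly for the shorter blocks in the induction hypothesis.
      (fun u v hu hv h4 h5 => by
        refine padicIdeal_mono ?_ (ih (s - (t + 1)) (by omega) K _)
        have h6 : (v + p * u) / p = u := by
          rw [Nat.add_mul_div_left _ _ hp.out.pos, Nat.div_eq_of_lt hv, zero_add]
        have h7 := ((bigRun_of_minimal h5 (by rwa [h6])).add_mul (m := m)).add_bigCount_le
        rw [Nat.add_mul_div_right _ _ (pow_pos hp.out.pos _), Nat.div_eq_of_lt, zero_add] at h7
        · omega
        · calc v + p * u < p * (u + 1) := by rw [mul_add]; omega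
            _ ≤ p * p ^ t := Nat.mul_le_mul_left _ hu
            _ = p ^ (t + 1) := (pow_succ' _ _).symm)
    have h4 := add_mem h1 h3
    rwa [sub_add_sub_cancel] at h4

/-- The parameter `t` interpolates between single terms weighted by `A (j + m * p ^ s) / A j` at `t
= 0` and, at `t = s`, the whole block `0` weighted by `A m`. Each step drops one digit from the
weight. -/
theorem IsDworkSequence.dworkSum_transfer (hA : IsDworkSequence p M A) (ha : a < p) {s : ℕ}
    (ih : ∀ s' < s, ∀ K m, dworkSum p A a K s' m ∈ padicIdeal p (s' + 1 + bigCount M p m))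
    (K m t : ℕ) (ht : t ≤ s) :
    dworkSum p A a (K + m * p ^ s) s m - smallSum p M (s - t)
      (fun j => A (j + m * p ^ (s - t)) / A j * dworkSum p A a K t j) ∈
      padicIdeal p (s + 1 + bigCount M p m) := by
  induction t with
  | zero =>
    have h1 := dworkSum_sub_smallSum_mem ih (K + m * p ^ s) m s le_rfl
    have h2 : smallSum p M s (fun n => dworkSum p A a (K + m * p ^ s) (s - s) (n + m * p ^ s)) -
        smallSum p M (s - 0) (fun j => A (j + m * p ^ (s - 0)) / A j * dworkSum p A a K 0 j) ∈
        padicIdeal p (s + 1 + bigCount M p m) := by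
      rw [smallSum, smallSum, Nat.sub_zero, Nat.sub_self, ← Finset.sum_sub_distrib]
      refine sum_mem fun j _ => ?_
      split_ifs with hj
      · rw [dworkSum_zero, dworkSum_zero]
        exact hA.dworkTerm_sub_mem ha hj K m
      · simp
    have h3 := add_mem h1 h2
    rwa [sub_add_sub_cancel] at h3
  | succ t iht =>
    have h1 := iht (by omega)
    obtain ⟨d, hd⟩ : ∃ d, s - t = d + 1 := ⟨s - t - 1, by omega⟩
    have hd' : s - (t + 1) = d := by omega
    rw [hd] at h1
    rw [hd']
    -- The weight in `g` depends only on `j / p`, so it factors out of the sum over the last digit.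
    -- On small integers there is no run, so `congr` bounds the change of weight; its loss is
    -- recovered from the induction hypothesis on `dworkSum`.
    have h2 := smallSum_step (p := p) (M := M) (I := padicIdeal p (s + 1 + bigCount M p m)) (t := d)
      (g := fun j => A (j / p + m * p ^ d) / A (j / p) * dworkSum p A a K t j)
      (h := fun j => A (j + m * p ^ (d + 1)) / A j * dworkSum p A a K t j)
      (fun u v _ hv hu h5 => by
        have h6 : (v + p * u) / p = u := by
          rw [Nat.add_mul_div_left _ _ hp.out.pos, Nat.div_eq_of_lt hv, zero_add]
        simp only [h6]
        rw [← sub_mul, ← neg_sub, neg_mul]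
        refine neg_mem ?_
        have hrun : ¬ BigRun M p (v + p * u) (d + 1) := by
          intro hrun
          have h7 := hrun (d + 1) (by omega) le_rfl
          have h8 := Nat.mul_le_mul_left M (Nat.mod_le (v + p * u) (p ^ (d + 1)))
          omega
        refine padicIdeal_mul_of_le (hA.congr d u v m hv hu hrun) (ih t (by omega) K _) ?_
        omega)
      (fun u v _ hv hu h5 => by
        have h6 : (v + p * u) / p = u := by
          rw [Nat.add_mul_div_left _ _ hp.out.pos, Nat.div_eq_of_lt hv, zero_add]
        simp only [h6]
        have h7 := (bigRun_of_minimal h5 (by rwa [h6])).le_bigCount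
        refine padicIdeal_mul_of_le (hA.div_mem d u m hu) (ih t (by omega) K _) ?_
        omega)
    have h3 : smallSum p M d (fun u => ∑ v ∈ Finset.range p,
        A ((v + p * u) / p + m * p ^ d) / A ((v + p * u) / p) * dworkSum p A a K t (v + p * u)) =
        smallSum p M d (fun j => A (j + m * p ^ d) / A j * dworkSum p A a K (t + 1) j) := by
      rw [smallSum, smallSum]
      refine Finset.sum_congr rfl fun u _ => ?_
      rw [dworkSum_succ, Finset.mul_sum]
      congr 1
      refine Finset.sum_congr rfl fun v hv => ?_
      rw [Nat.add_mul_div_left _ _ hp.out.pos, Nat.div_eq_of_lt (Finset.mem_range.1 hv), zero_add]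
    rw [h3] at h2
    have h4 := sub_mem h1 h2
    convert h4 using 1
    ring

/-- **Formal congruences** (Dwork). -/
theorem IsDworkSequence.dworkSum_mem (hA : IsDworkSequence p M A) (ha : a < p) (s K m : ℕ) :
    dworkSum p A a K s m ∈ padicIdeal p (s + 1 + bigCount M p m) := by
  induction s using Nat.strong_induction_on generalizing K m with
  | _ s ih =>
  -- Block `m` for `K + m * p ^ s` reduces to block `0` for `K`.
  have htr : ∀ K m, dworkSum p A a K s 0 ∈ padicIdeal p (s + 1) →
      dworkSum p A a (K + m * p ^ s) s m ∈ padicIdeal p (s + 1 + bigCount M p m) := by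
    intro K m h0
    have h1 := hA.dworkSum_transfer ha ih K m s le_rfl
    have h2 : smallSum p M (s - s)
        (fun j => A (j + m * p ^ (s - s)) / A j * dworkSum p A a K s j) =
        A m * dworkSum p A a K s 0 := by
      simp [smallSum, hA.zero]
    rw [h2] at h1
    have h3 := add_mem h1 (padicIdeal_mul_of_le (hA.mem m) h0 (add_comm _ _).le)
    rwa [sub_add_cancel] at h3
  -- Induction on `K`: since all blocks sum to zero, block `0` is minus the sum of the others, and
  -- each nonzero one of these is tied by `htr` to block `0` for a strictly smaller `K`.
  have h0 : ∀ K, dworkSum p A a K s 0 ∈ padicIdeal p (s + 1) := by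
    intro K
    induction K using Nat.strong_induction_on with
    | _ K ihK =>
    have hps := pow_pos hp.out.pos s
    have h1 := sum_dworkSum_eq_zero (p := p) (A := A) (a := a) K s (K + 1)
      (lt_of_lt_of_le (Nat.lt_succ_self K) (Nat.le_mul_of_pos_right _ hps))
    rw [Finset.sum_range_succ'] at h1
    rw [eq_neg_of_add_eq_zero_right h1]
    refine neg_mem (sum_mem fun m _ => ?_)
    by_cases hK : K < (m + 1) * p ^ s
    · rw [dworkSum_eq_zero hK]
      exact AddSubgroup.zero_mem _
    · obtain ⟨K', rfl⟩ := Nat.exists_eq_add_of_le' (not_lt.1 hK)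
      have hpos : 0 < (m + 1) * p ^ s := by positivity
      exact padicIdeal_mono (by omega) (htr K' (m + 1) (ihK K' (by omega)))
  by_cases hK : K < m * p ^ s
  · rw [dworkSum_eq_zero hK]
    exact AddSubgroup.zero_mem _
  · obtain ⟨K', rfl⟩ := Nat.exists_eq_add_of_le' (not_lt.1 hK)
    exact htr K' m (h0 K')

end

/-! ### In case (i), `Q` is a Dwork sequence -/

section

variable {p : ℕ} [hp : Fact p.Prime] {r s : ℕ} {e : Fin r → ℕ} {f : Fin s → ℕ}

theorem floorDiff_eq_zero_of_mod_lt (hsum : ∑ i, e i = ∑ j, f j) {n q : ℕ}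
    (h : maxTerm e f * (n % q) < q) : floorDiff e f n q = 0 := by
  rw [floorDiff_mod hsum n q (by omega)]
  exact floorDiff_eq_zero_of_lt h

theorem indicator_le_floorDiff (hsum : ∑ i, e i = ∑ j, f j)
    (hΔ : ∀ n q, 0 < q → q ≤ maxTerm e f * (n % q) → 1 ≤ floorDiff e f n q) (n l : ℕ) :
    (if p ^ l ≤ maxTerm e f * (n % p ^ l) then 1 else 0) ≤ floorDiff e f n (p ^ l) := by
  split_ifs with h
  · exact hΔ n _ (pow_pos hp.out.pos l) h
  · exact (floorDiff_eq_zero_of_mod_lt hsum (not_le.1 h)).ge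

theorem factorialRatio_mem (hsum : ∑ i, e i = ∑ j, f j)
    (hΔ : ∀ n q, 0 < q → q ≤ maxTerm e f * (n % q) → 1 ≤ floorDiff e f n q) (n : ℕ) :
    factorialRatio e f n ∈ padicIdeal p (bigCount (maxTerm e f) p n) := by
  have h1 : maxTerm e f * n < p ^ (maxTerm e f * n + 1) :=
    (Nat.lt_succ_self _).trans (Nat.lt_pow_self hp.out.one_lt)
  rw [mem_padicIdeal, padicNorm_factorialRatio h1 (Nat.succ_pos _)]
  refine zpow_le_zpow_right₀ one_lt_prime_rat.le (neg_le_neg ?_)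
  refine le_trans ?_ (Finset.sum_le_sum fun l _ => indicator_le_floorDiff hsum hΔ n l)
  rw [Finset.sum_boole]
  rfl

/-- Compares both values through Legendre's formula, level by level, and keeps the contributions of
the levels of `m` shifted by `t`. -/
theorem factorialRatio_div_mem (hsum : ∑ i, e i = ∑ j, f j) (hM : 0 < maxTerm e f)
    (hΔ : ∀ n q, 0 < q → q ≤ maxTerm e f * (n % q) → 1 ≤ floorDiff e f n q) (t u m : ℕ)
    (hu : maxTerm e f * u < p ^ t) :
    factorialRatio e f (u + m * p ^ t) / factorialRatio e f u ∈
      padicIdeal p (bigCount (maxTerm e f) p m) := by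
  set M := maxTerm e f with hMdef
  set N := u + m * p ^ t with hN
  have hut : u < p ^ t := lt_of_le_of_lt (Nat.le_mul_of_pos_left u hM) hu
  have hp0 := (prime_pos_rat (p := p)).ne'
  have h1 : M * N < p ^ (M * N + 1) :=
    (Nat.lt_succ_self _).trans (Nat.lt_pow_self hp.out.one_lt)
  have h2 : M * u < p ^ (M * N + 1) :=
    lt_of_le_of_lt (Nat.mul_le_mul_left _ (Nat.le_add_right _ _)) h1
  rw [mem_padicIdeal, padicNorm.div, padicNorm_factorialRatio h1 (Nat.succ_pos _),
    padicNorm_factorialRatio h2 (Nat.succ_pos _), ← zpow_sub₀ hp0]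
  refine zpow_le_zpow_right₀ one_lt_prime_rat.le ?_
  have h3 : (bigCount M p m : ℤ) ≤ ∑ l ∈ Finset.Ico 1 (M * N + 1),
      (floorDiff e f N (p ^ l) - floorDiff e f u (p ^ l)) := by
    have hsub : (bigLevels M p m).map (addLeftEmbedding t) ⊆ bigLevels M p N := by
      intro l hl
      rw [Finset.mem_map] at hl
      obtain ⟨l', hl', rfl⟩ := hl
      refine add_mem_bigLevels ?_
      rwa [hN, Nat.add_mul_div_right _ _ (pow_pos hp.out.pos _), Nat.div_eq_of_lt hut, zero_add]
    have h4 : (bigCount M p m : ℤ) = ∑ l ∈ Finset.Ico 1 (M * N + 1),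
        if l ∈ (bigLevels M p m).map (addLeftEmbedding t) then (1 : ℤ) else 0 := by
      rw [Finset.sum_boole, Finset.filter_mem_eq_inter, Finset.inter_eq_right.2, Finset.card_map]
      · rfl
      · refine hsub.trans ?_
        rw [bigLevels]
        exact Finset.filter_subset _ _
    rw [h4]
    refine Finset.sum_le_sum fun l _ => ?_
    -- Up to level `t` the residues of `N` and `u` agree and their contributions cancel. Beyond it
    -- `u` contributes nothing.
    rcases le_or_gt l t with hlt | hlt
    · have h5 : N % p ^ l = u % p ^ l := by
        obtain ⟨d, rfl⟩ := Nat.exists_eq_add_of_le hlt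
        rw [hN, pow_add, mul_left_comm, Nat.add_mul_mod_self_left]
      rw [floorDiff_mod hsum N _ (pow_pos hp.out.pos l), h5,
        ← floorDiff_mod hsum u _ (pow_pos hp.out.pos l), sub_self, if_neg]
      intro h6
      rw [Finset.mem_map] at h6
      obtain ⟨l', hl', rfl⟩ := h6
      rw [mem_bigLevels] at hl'
      rw [addLeftEmbedding_apply] at hlt
      omega
    · have h5 : floorDiff e f u (p ^ l) = 0 := floorDiff_eq_zero_of_lt
        (hu.trans_le (Nat.pow_le_pow_right hp.out.pos hlt.le))
      rw [h5, sub_zero]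
      refine le_trans ?_ (indicator_le_floorDiff hsum hΔ N l)
      split_ifs with h6 h7
      · exact le_rfl
      · exact absurd (mem_bigLevels.1 (hsub h6)).2 h7
      · exact zero_le_one
      · exact le_rfl
  rw [Finset.sum_sub_distrib] at h3
  omega

theorem shiftRatio_add_div {k : ℤ} {E : Fin r → ℕ} {F : Fin s → ℕ} {u d : ℕ}
    (he : ∀ i, ∀ n < E i, ((e i * (u + d) + n + 1 : ℕ) : ℚ) / (e i * u + n + 1 : ℕ) ∈ oneUnits p k)
    (hf : ∀ j, ∀ n < F j, ((f j * (u + d) + n + 1 : ℕ) : ℚ) / (f j * u + n + 1 : ℕ) ∈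
      oneUnits p k) :
    shiftRatio e f E F (u + d) / shiftRatio e f E F u ∈ oneUnits p k := by
  rw [shiftRatio, shiftRatio, div_div_div_comm, ← Finset.prod_div_distrib,
    ← Finset.prod_div_distrib]
  simp only [← Finset.prod_div_distrib]
  refine oneUnits_div ?_ ?_
  · exact Submonoid.prod_mem _ fun i _ => Submonoid.prod_mem _ fun n hn =>
      he i n (Finset.mem_range.1 hn)
  · exact Submonoid.prod_mem _ fun j _ => Submonoid.prod_mem _ fun n hn =>
      hf j n (Finset.mem_range.1 hn)

theorem factorialRatio_div_div (hsum : ∑ i, e i = ∑ j, f j) (t u v m : ℕ) :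
    factorialRatio e f (v + p * u + m * p ^ (t + 1)) / factorialRatio e f (v + p * u) =
      factorialRatio e f (u + m * p ^ t) / factorialRatio e f u *
      (unitRatio p e f (v + p * u + m * p ^ (t + 1)) / unitRatio p e f (v + p * u) *
      (shiftRatio e f (fun i => e i * v / p) (fun j => f j * v / p) (u + m * p ^ t) /
        shiftRatio e f (fun i => e i * v / p) (fun j => f j * v / p) u)) := by
  have h1 : v + p * u + m * p ^ (t + 1) = v + p * (u + m * p ^ t) := by ring
  rw [h1, factorialRatio_add_mul hsum (u + m * p ^ t) v, factorialRatio_add_mul hsum u v]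
  have := factorialRatio_ne_zero (e := e) (f := f) u
  have := unitRatio_ne_zero (p := p) (e := e) (f := f) (v + p * u)
  have := shiftRatio_ne_zero (e := e) (f := f) (E := fun i => e i * v / p)
    (F := fun j => f j * v / p) u
  have := zpow_ne_zero (floorDiff e f v p) (prime_pos_rat (p := p)).ne'
  field_simp

/-- By `factorialRatio_div_div` the relative error is a product of a `unitRatio` quotient and a
`shiftRatio` quotient. The first is `1` mod `p ^ (t + 1)`; the second loses at most the length of
the initial run of `v + p * u`. -/
theorem factorialRatio_congr (hsum : ∑ i, e i = ∑ j, f j) (hM : 0 < maxTerm e f)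
    (hΔ : ∀ n q, 0 < q → q ≤ maxTerm e f * (n % q) → 1 ≤ floorDiff e f n q) (t u v m : ℕ)
    (hv : v < p) (hu : maxTerm e f * u < p ^ t)
    (hrun : ¬ BigRun (maxTerm e f) p (v + p * u) (t + 1)) :
    factorialRatio e f (v + p * u + m * p ^ (t + 1)) / factorialRatio e f (v + p * u) -
      factorialRatio e f (u + m * p ^ t) / factorialRatio e f u ∈
      padicIdeal p (t + 1 + bigCount (maxTerm e f) p m -
        bigCount (maxTerm e f) p (v + p * u)) := by
  classical
  set M := maxTerm e f with hMdef
  -- `w` is the exact length of the initial run: `p ^ w` dividing a factor `c * u + k + 1` would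
  -- lengthen it to `w + 1`.
  obtain ⟨w, hw, hw', hwt⟩ : ∃ w, BigRun M p (v + p * u) w ∧ ¬ BigRun M p (v + p * u) (w + 1) ∧
      w ≤ t := by
    have hex : ∃ w, ¬ BigRun M p (v + p * u) w := ⟨_, hrun⟩
    have hpos : Nat.find hex ≠ 0 := by
      intro h0
      have := Nat.find_spec hex
      rw [h0] at this
      exact this fun l h1 h2 => by omega
    obtain ⟨w, hw⟩ := Nat.exists_eq_succ_of_ne_zero hpos
    refine ⟨w, ?_, ?_, ?_⟩
    · have := Nat.find_min hex (m := w) (by omega)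
      exact not_not.1 this
    · have := Nat.find_spec hex
      rwa [hw] at this
    · have := Nat.find_min' hex hrun
      omega
  have hfac : ∀ c ≤ M, ∀ k < c * v / p,
      ((c * (u + m * p ^ t) + k + 1 : ℕ) : ℚ) / (c * u + k + 1 : ℕ) ∈
        oneUnits p ((t : ℤ) + 1 - w) := by
    intro c hc k hk
    have hnd : ¬ p ^ w ∣ c * u + (k + 1) := fun h =>
      hw' (bigRun_of_dvd hc hv (Nat.succ_pos k) hk h)
    obtain ⟨w, rfl⟩ : ∃ w', w = w' + 1 := by
      refine Nat.exists_eq_succ_of_ne_zero ?_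
      rintro rfl
      simp at hnd
    refine mem_oneUnits_of_pos (by omega) ?_
    have h0 : ((c * u + k + 1 : ℕ) : ℚ) ≠ 0 := by positivity
    have h1 : ((c * (u + m * p ^ t) + k + 1 : ℕ) : ℚ) / (c * u + k + 1 : ℕ) - 1 =
        ((c * m * p ^ t : ℕ) : ℚ) * ((c * u + k + 1 : ℕ) : ℚ)⁻¹ := by
      field_simp
      push_cast
      ring
    rw [h1]
    refine padicIdeal_mul_of_le (natCast_mem_padicIdeal_iff.2 (Dvd.intro_left _ rfl))
      (inv_natCast_mem_padicIdeal hnd) ?_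
    push_cast
    omega
  have h1 := shiftRatio_add_div (p := p) (e := e) (f := f) (fun i => hfac _ (le_maxTerm_left i))
    (fun j => hfac _ (le_maxTerm_right j))
  have h2 := oneUnits_mono (l := (t : ℤ) + 1 - w) (by push_cast; omega)
    (unitRatio_add_div (p := p) hsum (v + p * u) m t)
  have h3 := (mul_mem h2 h1).1
  rw [factorialRatio_div_div hsum, ← mul_sub_one]
  have h4 : factorialRatio e f (u + m * p ^ t) / factorialRatio e f u ∈
      padicIdeal p (bigCount M p m) := factorialRatio_div_mem hsum hM hΔ t u m hu
  refine padicIdeal_mul_of_le h4 h3 ?_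
  have := hw.le_bigCount
  omega

theorem isDworkSequence_factorialRatio (hsum : ∑ i, e i = ∑ j, f j) (hM : 0 < maxTerm e f)
    (hΔ : ∀ n q, 0 < q → q ≤ maxTerm e f * (n % q) → 1 ≤ floorDiff e f n q) :
    IsDworkSequence p (maxTerm e f) (factorialRatio e f) where
  zero := factorialRatio_zero
  mem := factorialRatio_mem hsum hΔ
  div_mem := factorialRatio_div_mem hsum hM hΔ
  ne_zero := factorialRatio_ne_zero
  congr := fun t u v m hv hu hrun => factorialRatio_congr hsum hM hΔ t u v m hv hu hrun

end

/-! ### Congruences for harmonic numbers -/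

section

variable {p : ℕ} [hp : Fact p.Prime] {M : ℕ} {A : ℕ → ℚ} {a L : ℕ}

/-- The terms of `p H_N` with index divisible by `p` add up to `H_{N/p}`; every other term is in `p
ℤ_(p)`. -/
theorem prime_mul_harmonic_sub_mem (N : ℕ) :
    (p : ℚ) * harmonic N - harmonic (N / p) ∈ padicIdeal p 1 := by
  induction N with
  | zero => simp
  | succ N ih =>
    rw [harmonic_succ, Nat.succ_div]
    split_ifs with h
    · have h1 : N + 1 = p * (N / p + 1) := by
        have := Nat.div_mul_cancel h
        rw [Nat.succ_div, if_pos h] at this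
        rw [mul_comm]; exact this.symm
      have h2 : (p : ℚ) * ((N + 1 : ℕ) : ℚ)⁻¹ = ((N / p + 1 : ℕ) : ℚ)⁻¹ := by
        rw [h1, Nat.cast_mul]
        have := (prime_pos_rat (p := p)).ne'
        field_simp
      rw [harmonic_succ, mul_add, h2, add_sub_add_right_eq_sub]
      exact ih
    · rw [add_zero, mul_add, add_sub_right_comm]
      refine add_mem ih (padicIdeal_mul_of_le prime_mem_padicIdeal
        (inv_natCast_mem_padicIdeal (t := 0) (by simpa using h)) (by simp))

theorem harmonic_add_sub (a b : ℕ) :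
    harmonic (a + b) - harmonic a = ∑ k ∈ Finset.range b, ((a + k + 1 : ℕ) : ℚ)⁻¹ := by
  rw [harmonic, harmonic, Finset.sum_range_add, add_sub_cancel_left]

/-- The discrepancy consists of the terms `1 / (L j + k)` with `1 ≤ k ≤ ⌊L a / p⌋`. By
`bigRun_of_dvd`, `A (a + p * j)` cancels each such denominator with one power of `p` to spare. -/
theorem IsDworkSequence.mul_harmonic_mem (hA : IsDworkSequence p M A) (ha : a < p) (hL : L ≤ M)
    (j : ℕ) :
    A (a + p * j) * (p * harmonic (L * (a + p * j)) - harmonic (L * j)) ∈ padicIdeal p 1 := by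
  have h1 : L * (a + p * j) / p = L * j + L * a / p := by
    rw [mul_add, mul_left_comm, Nat.add_mul_div_left _ _ hp.out.pos, add_comm]
  have h2 := prime_mul_harmonic_sub_mem (p := p) (L * (a + p * j))
  rw [h1] at h2
  have h3 : A (a + p * j) * (p * harmonic (L * (a + p * j)) - harmonic (L * j)) =
      A (a + p * j) * (p * harmonic (L * (a + p * j)) - harmonic (L * j + L * a / p)) +
      A (a + p * j) * (harmonic (L * j + L * a / p) - harmonic (L * j)) := by ring
  rw [h3, harmonic_add_sub, Finset.mul_sum]
  refine add_mem (padicIdeal_mul_of_le (hA.mem_zero _) h2 (by simp)) (sum_mem fun k hk => ?_)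
  have hnd : ¬ p ^ bigCount M p (a + p * j) ∣ L * j + (k + 1) := fun h => by
    have := (bigRun_of_dvd hL ha (Nat.succ_pos k) (Finset.mem_range.1 hk) h).le_bigCount
    omega
  obtain ⟨w, hw⟩ : ∃ w, bigCount M p (a + p * j) = w + 1 := by
    refine Nat.exists_eq_succ_of_ne_zero fun h => ?_
    rw [h] at hnd
    simp at hnd
  have h4 := hA.mem (a + p * j)
  rw [hw] at hnd h4
  refine padicIdeal_mul_of_le h4 (inv_natCast_mem_padicIdeal hnd) ?_
  push_cast
  omega

/-- A denominator divisible by `p ^ (s + 1)` is `p ^ (s + 1) * (L * (m / p) + k')` with `1 ≤ k' ≤ ⌊L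
(m mod p) / p⌋`. One more power of `p` than claimed would produce a run of `m` longer than `bigCount
M p m`. -/
theorem harmonic_block_sub_mem (hL : L ≤ M) (s m : ℕ) :
    harmonic (L * (m * p ^ s)) - harmonic (L * (m / p * p ^ (s + 1))) ∈
      padicIdeal p (-(s + bigCount M p m : ℕ)) := by
  have h1 : L * (m * p ^ s) = L * (m / p * p ^ (s + 1)) + L * (m % p) * p ^ s := by
    conv_lhs => rw [← Nat.mod_add_div m p]
    ring
  rw [h1, harmonic_add_sub]
  refine sum_mem fun k hk => inv_natCast_mem_padicIdeal fun h => ?_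
  rw [Finset.mem_range] at hk
  have hdvd : p ^ (s + 1) ∣ k + 1 := by
    have h2 : p ^ (s + 1) ∣ L * (m / p * p ^ (s + 1)) + (k + 1) :=
      (pow_dvd_pow p (by omega)).trans h
    refine (Nat.dvd_add_right ?_).1 h2
    exact Dvd.intro_left _ (mul_assoc _ _ _)
  obtain ⟨k', hk'⟩ := hdvd
  have hk1 : 1 ≤ k' := by
    rcases Nat.eq_zero_or_pos k' with rfl | h0
    · simp at hk'
    · exact h0
  have hk2 : k' ≤ L * (m % p) / p := by
    rw [Nat.le_div_iff_mul_le hp.out.pos]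
    have h3 : p ^ s * (k' * p) ≤ p ^ s * (L * (m % p)) := by
      calc p ^ s * (k' * p) = k + 1 := by rw [hk']; ring
        _ ≤ L * (m % p) * p ^ s := hk
        _ = _ := mul_comm _ _
    exact Nat.le_of_mul_le_mul_left h3 (pow_pos hp.out.pos s)
  have h4 : p ^ bigCount M p m ∣ L * (m / p) + k' := by
    have h5 : L * (m / p * p ^ (s + 1)) + k + 1 = p ^ (s + 1) * (L * (m / p) + k') := by
      rw [add_assoc, hk']; ring
    rw [h5, add_right_comm, pow_add p (s + 1)] at h
    exact Nat.dvd_of_mul_dvd_mul_left (pow_pos hp.out.pos _) h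
  have h6 := (bigRun_of_dvd hL (Nat.mod_lt m hp.out.pos) hk1 hk2 h4).le_bigCount
  rw [Nat.mod_add_div] at h6
  omega

theorem IsDworkSequence.sum_dworkTerm_mul_harmonic_mem (hA : IsDworkSequence p M A) (ha : a < p)
    (hL : L ≤ M) (K : ℕ) :
    ∑ j ∈ Finset.range (K + 1), dworkTerm p A a K j * harmonic (L * j) ∈ padicIdeal p 1 := by
  have h1 : ∑ j ∈ Finset.range (K + 1), dworkTerm p A a K j * harmonic (L * j) =
      ∑ j ∈ Finset.range (p ^ K), dworkTerm p A a K j * harmonic (L * j) := by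
    refine Finset.sum_subset (Finset.range_subset_range.2 (Nat.lt_pow_self hp.out.one_lt)) ?_
    intro j _ hj
    rw [Finset.mem_range] at hj
    rw [dworkTerm, if_neg (by omega), zero_mul]
  -- Telescoping over the truncations of `j` to multiples of `p ^ s`. Since `j < p ^ K`, the
  -- truncation at `s = K` is `0`.
  have h2 : ∀ j ∈ Finset.range (p ^ K), dworkTerm p A a K j * harmonic (L * j) =
      ∑ s ∈ Finset.range K, dworkTerm p A a K j * (harmonic (L * (j / p ^ s * p ^ s)) -
        harmonic (L * (j / p ^ (s + 1) * p ^ (s + 1)))) := by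
    intro j hj
    rw [← Finset.mul_sum, Finset.sum_range_sub' (fun s => harmonic (L * (j / p ^ s * p ^ s))),
      Nat.div_eq_of_lt (Finset.mem_range.1 hj)]
    simp
  rw [h1, Finset.sum_congr rfl h2, Finset.sum_comm]
  refine sum_mem fun s hs => ?_
  rw [Finset.mem_range] at hs
  obtain ⟨d, hd⟩ := Nat.exists_eq_add_of_le' hs.le
  rw [hd, pow_add, sum_range_mul]
  refine sum_mem fun m _ => ?_
  have h3 : ∑ i ∈ Finset.range (p ^ s), dworkTerm p A a (d + s) (i + m * p ^ s) *
      (harmonic (L * ((i + m * p ^ s) / p ^ s * p ^ s)) -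
        harmonic (L * ((i + m * p ^ s) / p ^ (s + 1) * p ^ (s + 1)))) =
      dworkSum p A a (d + s) s m *
        (harmonic (L * (m * p ^ s)) - harmonic (L * (m / p * p ^ (s + 1)))) := by
    rw [dworkSum, Finset.sum_mul]
    refine Finset.sum_congr rfl fun i hi => ?_
    have h4 : (i + m * p ^ s) / p ^ s = m := by
      rw [Nat.add_mul_div_right _ _ (pow_pos hp.out.pos _),
        Nat.div_eq_of_lt (Finset.mem_range.1 hi), zero_add]
    have h5 : (i + m * p ^ s) / p ^ (s + 1) = m / p := by
      rw [pow_succ, ← Nat.div_div_eq_div_mul, h4]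
    rw [h4, h5]
  rw [h3]
  refine padicIdeal_mul_of_le (hA.dworkSum_mem ha s (d + s) m) (harmonic_block_sub_mem hL s m) ?_
  push_cast
  omega

/-- The congruences on which the integrality of `q_L` rests. -/
theorem IsDworkSequence.sum_mul_harmonic_mem (hA : IsDworkSequence p M A) (ha : a < p)
    (hL : L ≤ M) (K : ℕ) :
    ∑ j ∈ Finset.range (K + 1), A (a + p * j) * A (K - j) *
      (harmonic (L * (K - j)) - p * harmonic (L * (a + p * j))) ∈ padicIdeal p 1 := by
  have h1 : ∑ j ∈ Finset.range (K + 1), A (a + p * j) * A (K - j) * harmonic (L * (K - j)) =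
      ∑ j ∈ Finset.range (K + 1), A (a + p * (K - j)) * A j * harmonic (L * j) := by
    rw [← Finset.sum_range_reflect]
    refine Finset.sum_congr rfl fun j hj => ?_
    rw [Finset.mem_range] at hj
    have h2 : K + 1 - 1 - j = K - j := by omega
    have h3 : K - (K - j) = j := by omega
    rw [h2, h3]
  -- `H_{Lj}` is inserted next to `p * H_{L(a + pj)}`, and the sum with `H_{L(K-j)}` is reflected by
  -- `j ↦ K - j`; together they form the antisymmetric sum.
  have h2 : ∑ j ∈ Finset.range (K + 1), A (a + p * j) * A (K - j) *
      (harmonic (L * (K - j)) - p * harmonic (L * (a + p * j))) =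
      -(∑ j ∈ Finset.range (K + 1), dworkTerm p A a K j * harmonic (L * j)) -
      ∑ j ∈ Finset.range (K + 1), A (K - j) *
        (A (a + p * j) * (p * harmonic (L * (a + p * j)) - harmonic (L * j))) := by
    simp only [mul_sub (A _ * A _), Finset.sum_sub_distrib]
    rw [h1]
    have h3 : ∑ j ∈ Finset.range (K + 1), dworkTerm p A a K j * harmonic (L * j) =
        ∑ j ∈ Finset.range (K + 1), (A (a + p * j) * A (K - j) * harmonic (L * j) -
          A (a + p * (K - j)) * A j * harmonic (L * j)) := by
      refine Finset.sum_congr rfl fun j hj => ?_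
      rw [Finset.mem_range] at hj
      rw [dworkTerm, if_pos (by omega)]
      ring
    have h4 : ∑ j ∈ Finset.range (K + 1), A (K - j) *
        (A (a + p * j) * (p * harmonic (L * (a + p * j)) - harmonic (L * j))) =
        ∑ j ∈ Finset.range (K + 1), (A (a + p * j) * A (K - j) * (p * harmonic (L * (a + p * j))) -
          A (a + p * j) * A (K - j) * harmonic (L * j)) :=
      Finset.sum_congr rfl fun j _ => by ring
    rw [h3, h4, Finset.sum_sub_distrib, Finset.sum_sub_distrib]
    ring
  rw [h2]
  refine sub_mem (neg_mem (hA.sum_dworkTerm_mul_harmonic_mem ha hL K)) (sum_mem fun j _ => ?_)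
  exact padicIdeal_mul_of_le (hA.mem_zero _) (hA.mul_harmonic_mem ha hL j) (by simp)

end

/-! ### Exponentials of power series -/

open PowerSeries

/-- The power series over `ℚ` all of whose coefficients lie in `p ^ k ℤ_(p)`. -/
def padicSeries (p : ℕ) [Fact p.Prime] (k : ℤ) : AddSubgroup (PowerSeries ℚ) where
  carrier := {h | ∀ n, coeff n h ∈ padicIdeal p k}
  zero_mem' := fun n => by simp
  add_mem' := fun ha hb n => by rw [map_add]; exact add_mem (ha n) (hb n)
  neg_mem' := fun ha n => by rw [map_neg]; exact neg_mem (ha n)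

section ExpOf

theorem derivative_expOf {h : PowerSeries ℚ} (h0 : constantCoeff h = 0) :
    derivative ℚ (expOf h) = expOf h * derivative ℚ h := by
  rw [expOf, derivative_subst (HasSubst.of_constantCoeff_zero' h0), derivative_exp]

theorem constantCoeff_expOf {h : PowerSeries ℚ} (h0 : constantCoeff h = 0) :
    constantCoeff (expOf h) = 1 := by
  rw [← coeff_zero_eq_constantCoeff_apply, expOf, coeff_subst' (HasSubst.of_constantCoeff_zero' h0),
    finsum_eq_single _ 0]
  · simp
  · intro n hn
    simp [h0, hn]

/-- The quotient `y / z` has zero derivative. The functional equations of `expOf` below follow from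
this uniqueness. -/
theorem eq_of_derivative_eq_mul {y z c : PowerSeries ℚ} (hy : constantCoeff y = 1)
    (hz : constantCoeff z = 1) (hyc : derivative ℚ y = y * c) (hzc : derivative ℚ z = z * c) :
    y = z := by
  have hzz : z * z⁻¹ = 1 := PowerSeries.mul_inv_cancel z (by simp [hz])
  have h1 : y * z⁻¹ = 1 := by
    apply derivative.ext
    · rw [Derivation.leibniz, derivative_inv', hyc, hzc, derivative_one, smul_eq_mul, smul_eq_mul]
      linear_combination (-y * c * z⁻¹) * hzz
    · simp [hy, hz]
  calc y = y * z⁻¹ * z := by rw [mul_assoc, mul_comm z⁻¹, hzz, mul_one]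
    _ = z := by rw [h1, one_mul]

theorem expOf_add {a b : PowerSeries ℚ} (ha : constantCoeff a = 0) (hb : constantCoeff b = 0) :
    expOf (a + b) = expOf a * expOf b := by
  have hab : constantCoeff (a + b) = 0 := by rw [map_add, ha, hb, add_zero]
  refine eq_of_derivative_eq_mul (c := derivative ℚ (a + b)) (constantCoeff_expOf hab)
    (by rw [map_mul, constantCoeff_expOf ha, constantCoeff_expOf hb, one_mul])
    (derivative_expOf hab) ?_
  rw [Derivation.leibniz, derivative_expOf ha, derivative_expOf hb, map_add, smul_eq_mul,
    smul_eq_mul]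
  ring

theorem expOf_zero : expOf 0 = 1 :=
  eq_of_derivative_eq_mul (c := 0) (constantCoeff_expOf (map_zero _)) (map_one _)
    (by rw [derivative_expOf (map_zero _), map_zero]) (by rw [derivative_one, mul_zero])

theorem expOf_nsmul {a : PowerSeries ℚ} (ha : constantCoeff a = 0) (n : ℕ) :
    expOf (n • a) = expOf a ^ n := by
  induction n with
  | zero => rw [zero_smul, expOf_zero, pow_zero]
  | succ n ih => rw [succ_nsmul, expOf_add (by simp [ha]) ha, ih, pow_succ]

theorem expOf_sum {ι : Type*} (t : Finset ι) (g : ι → PowerSeries ℚ)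
    (hg : ∀ i ∈ t, constantCoeff (g i) = 0) : expOf (∑ i ∈ t, g i) = ∏ i ∈ t, expOf (g i) := by
  classical
  induction t using Finset.induction_on with
  | empty => simp [expOf_zero]
  | insert a t ha ih =>
    rw [Finset.sum_insert ha, Finset.prod_insert ha,
      expOf_add (hg a (Finset.mem_insert_self a t)), ih]
    · exact fun i hi => hg i (Finset.mem_insert_of_mem hi)
    · rw [map_sum]
      exact Finset.sum_eq_zero fun i hi => hg i (Finset.mem_insert_of_mem hi)

end ExpOf

/-! ### `p`-integral power series and the Dieudonné-Dwork lemma -/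

section

variable {p : ℕ} [hp : Fact p.Prime] {k l : ℤ}

theorem padicSeries_mul {g h : PowerSeries ℚ} (hg : g ∈ padicSeries p k) (hh : h ∈ padicSeries p l) :
    g * h ∈ padicSeries p (k + l) := fun n => by
  rw [coeff_mul]
  exact sum_mem fun x _ => padicIdeal_mul (hg _) (hh _)

theorem padicSeries_mul_zero {g h : PowerSeries ℚ} (hg : g ∈ padicSeries p 0)
    (hh : h ∈ padicSeries p k) : g * h ∈ padicSeries p k := by
  have := padicSeries_mul hg hh
  rwa [zero_add] at this

theorem one_mem_padicSeries : (1 : PowerSeries ℚ) ∈ padicSeries p 0 := fun n => by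
  rw [coeff_one]
  split_ifs
  · exact one_mem_padicIdeal
  · exact AddSubgroup.zero_mem _

theorem padicSeries_pow {g : PowerSeries ℚ} (hg : g ∈ padicSeries p 0) (n : ℕ) :
    g ^ n ∈ padicSeries p 0 := by
  induction n with
  | zero => rw [pow_zero]; exact one_mem_padicSeries
  | succ n ih => rw [pow_succ]; exact padicSeries_mul_zero ih hg

theorem padicSeries_inv {g : PowerSeries ℚ} (hg : g ∈ padicSeries p 0)
    (h1 : constantCoeff g = 1) : g⁻¹ ∈ padicSeries p 0 := fun n => by
  induction n using Nat.strong_induction_on with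
  | _ n ih =>
  rw [coeff_inv, h1, inv_one]
  split_ifs
  · exact one_mem_padicIdeal
  · rw [neg_one_mul]
    refine neg_mem (sum_mem fun x _ => ?_)
    split_ifs with h
    · exact padicIdeal_mul_of_le (hg _) (ih _ h) (by simp)
    · exact AddSubgroup.zero_mem _

theorem padicSeries_prod {ι : Type*} (t : Finset ι) (g : ι → PowerSeries ℚ)
    (hg : ∀ i ∈ t, g i ∈ padicSeries p 0) : ∏ i ∈ t, g i ∈ padicSeries p 0 := by
  classical
  induction t using Finset.induction_on with
  | empty => simpa using one_mem_padicSeries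
  | insert a t ha ih =>
    rw [Finset.prod_insert ha]
    exact padicSeries_mul_zero (hg a (Finset.mem_insert_self a t))
      (ih fun i hi => hg i (Finset.mem_insert_of_mem hi))

theorem expand_mem_padicSeries {g : PowerSeries ℚ} (hg : g ∈ padicSeries p k) :
    expand p hp.out.ne_zero g ∈ padicSeries p k := fun n => by
  by_cases h : p ∣ n
  · obtain ⟨m, rfl⟩ := h
    rw [coeff_expand_mul]
    exact hg m
  · rw [coeff_expand_of_not_dvd _ _ _ h]
    exact AddSubgroup.zero_mem _

theorem isPadicIntSeries_iff {h : PowerSeries ℚ} :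
    IsPadicIntSeries p h ↔ h ∈ padicSeries p 0 := by
  have key : ∀ x : ℚ, x ∈ padicIdeal p 0 ↔ ‖(x : ℚ_[p])‖ ≤ 1 := by
    intro x
    rw [padicIdeal_zero_iff, Padic.eq_padicNorm]
    exact_mod_cast Iff.rfl
  constructor
  · rintro ⟨g, hg⟩ n
    rw [key]
    have := congrArg (coeff n) hg
    simp only [coeff_map, eq_ratCast] at this
    rw [← this]
    exact (coeff n g).2
  · intro hh
    have hlift : ∀ n, ∃ y : ℤ_[p], (y : ℚ_[p]) = (coeff n h : ℚ) :=
      fun n => ⟨⟨_, (key _).1 (hh n)⟩, rfl⟩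
    choose y hy using hlift
    refine ⟨PowerSeries.mk y, ?_⟩
    ext n
    rw [coeff_map, coeff_map, PowerSeries.coeff_mk]
    exact hy n

/-- After reduction to `𝔽_p[[z]]` the `p`-th power is `t(z) ↦ t(z^p)`, because Frobenius fixes the
coefficients. -/
theorem pow_sub_expand_mem {t : PowerSeries ℚ} (ht : t ∈ padicSeries p 0) :
    t ^ p - expand p hp.out.ne_zero t ∈ padicSeries p 1 := by
  obtain ⟨T, hT⟩ := isPadicIntSeries_iff.2 ht
  have h1 : (T ^ p - expand p hp.out.ne_zero T).map PadicInt.toZMod = 0 := by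
    rw [map_sub, map_pow, map_expand, sub_eq_zero]
    have := MvPowerSeries.map_frobenius_expand p hp.out.ne_zero (R := ZMod p) (σ := Unit)
      (f := T.map PadicInt.toZMod)
    rw [ZMod.frobenius_zmod] at this
    rw [← this]
    exact congrFun (congrArg _ (MvPowerSeries.map_id)) _
  intro n
  have h2 := congrArg (coeff n) h1
  rw [coeff_map, map_zero] at h2
  have h3 : coeff n (T ^ p - expand p hp.out.ne_zero T) ∈ Ideal.span {(p : ℤ_[p]) ^ 1} := by
    rw [pow_one, ← PadicInt.maximalIdeal_eq_span_p, ← PadicInt.ker_toZMod]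
    exact h2
  rw [← PadicInt.norm_le_pow_iff_mem_span_pow] at h3
  have h4 : ((coeff n (T ^ p - expand p hp.out.ne_zero T) : ℤ_[p]) : ℚ_[p]) =
      ((coeff n (t ^ p - expand p hp.out.ne_zero t) : ℚ) : ℚ_[p]) := by
    have h5 : (T ^ p - expand p hp.out.ne_zero T).map (algebraMap ℤ_[p] ℚ_[p]) =
        (t ^ p - expand p hp.out.ne_zero t).map (algebraMap ℚ ℚ_[p]) := by
      rw [map_sub, map_sub, map_pow, map_pow, map_expand, map_expand, hT]
    have h6 := congrArg (coeff n) h5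
    simp only [coeff_map, eq_ratCast] at h6
    exact h6
  rw [PadicInt.norm_def, h4, Padic.eq_padicNorm] at h3
  rw [mem_padicIdeal]
  have h7 : ((padicNorm p (coeff n (t ^ p - expand p hp.out.ne_zero t)) : ℚ) : ℝ) ≤
    (((p : ℚ) ^ (-(1 : ℤ)) : ℚ) : ℝ) := by
    rw [Rat.cast_zpow, Rat.cast_natCast]
    exact h3
  exact_mod_cast h7

/-- The **Dieudonné-Dwork lemma**. -/
theorem mem_padicSeries_of_expand_eq {q w : PowerSeries ℚ} (hq : constantCoeff q = 1)
    (hw : constantCoeff w = 1) (hw1 : w - 1 ∈ padicSeries p 1)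
    (h : expand p hp.out.ne_zero q = q ^ p * w) : q ∈ padicSeries p 0 := fun n => by
  induction n using Nat.strong_induction_on with
  | _ n ih =>
  rcases Nat.eq_zero_or_pos n with rfl | hn
  · rw [coeff_zero_eq_constantCoeff_apply, hq]
    exact one_mem_padicIdeal
  -- `t` is the part of `q` already known to be integral, and `q = t + X ^ n * u` with `u` starting
  -- at the unknown coefficient.
  set t : PowerSeries ℚ := (trunc n q : PowerSeries ℚ) with ht
  have htc : ∀ m, coeff m t = if m < n then coeff m q else 0 := fun m => by
    rw [ht, Polynomial.coeff_coe, coeff_trunc]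
  have ht0 : t ∈ padicSeries p 0 := fun m => by
    rw [htc]
    split_ifs with hm
    · exact ih m hm
    · exact AddSubgroup.zero_mem _
  obtain ⟨u, hu⟩ : (X : PowerSeries ℚ) ^ n ∣ q - t := by
    rw [X_pow_dvd_iff]
    intro m hm
    rw [map_sub, htc, if_pos hm, sub_self]
  have hun : coeff n q = constantCoeff u := by
    have h1 := congrArg (coeff n) hu
    rw [map_sub, htc, if_neg (lt_irrefl n), sub_zero] at h1
    rw [h1]
    simpa using coeff_X_pow_mul u n 0
  have hqt : q = t + X ^ n * u := by rw [← hu]; ring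
  obtain ⟨y, hy⟩ := Polynomial.powAddExpansion t (X ^ n * u) p
  have hqp : q ^ p = t ^ p + X ^ n * ((p : PowerSeries ℚ) * t ^ (p - 1) * u + X ^ n * (y * u ^ 2)) := by
    rw [hqt, hy]; ring
  have htconst : constantCoeff t = 1 := by
    rw [← coeff_zero_eq_constantCoeff_apply, htc, if_pos hn, coeff_zero_eq_constantCoeff_apply, hq]
  have hcn : coeff n (q ^ p) = coeff n (t ^ p) + p * coeff n q := by
    rw [hqp, map_add]
    congr 1
    have := coeff_X_pow_mul ((p : PowerSeries ℚ) * t ^ (p - 1) * u + X ^ n * (y * u ^ 2)) n 0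
    rw [zero_add] at this
    rw [this, hun]
    simp [htconst, hn.ne']
  have hlow : ∀ m < n, coeff m (q ^ p) ∈ padicIdeal p 0 := by
    intro m hm
    rw [hqp, map_add, coeff_X_pow_mul', if_neg (by omega), add_zero]
    exact padicSeries_pow ht0 p m
  have hexp : coeff n (expand p hp.out.ne_zero q) = coeff n (expand p hp.out.ne_zero t) := by
    by_cases hd : p ∣ n
    · obtain ⟨m, rfl⟩ := hd
      rw [coeff_expand_mul, coeff_expand_mul, htc, if_pos]
      have := hp.out.two_le
      have : 0 < m := Nat.pos_of_mul_pos_left hn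
      nlinarith
    · rw [coeff_expand_of_not_dvd _ _ _ hd, coeff_expand_of_not_dvd _ _ _ hd]
  have hrest : coeff n (q ^ p * (w - 1)) ∈ padicIdeal p 1 := by
    rw [coeff_mul]
    refine sum_mem fun x hx => ?_
    rw [Finset.HasAntidiagonal.mem_antidiagonal] at hx
    rcases Nat.eq_zero_or_pos x.2 with h0 | h0
    · rw [h0, coeff_zero_eq_constantCoeff_apply, map_sub, hw, map_one, sub_self, mul_zero]
      exact AddSubgroup.zero_mem _
    · exact padicIdeal_mul_of_le (hlow _ (by omega)) (hw1 _) (by simp)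
  -- In degree `n`, `q(z^p)` sees only `t`, while `q ^ p` exceeds `t ^ p` by `p * coeff n q`.
  -- Everything else is divisible by `p`.
  have h1 : (p : ℚ) * coeff n q =
      -(coeff n (t ^ p - expand p hp.out.ne_zero t)) - coeff n (q ^ p * (w - 1)) := by
    have h2 := congrArg (coeff n) h
    have h3 : q ^ p * w = q ^ p + q ^ p * (w - 1) := by ring
    rw [hexp, h3, map_add, hcn] at h2
    rw [map_sub]
    linarith
  have h2 : (p : ℚ) * coeff n q ∈ padicIdeal p (0 + 1) := by
    rw [h1, zero_add]
    exact sub_mem (neg_mem (pow_sub_expand_mem ht0 n)) hrest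
  exact prime_mul_mem_iff.1 h2

/-- Legendre's bound `(p - 1) v(n!) < n` leaves at least one factor `p`. -/
theorem prime_pow_div_factorial_mem {n : ℕ} (hn : n ≠ 0) :
    (p : ℚ) ^ n * ((n ! : ℕ) : ℚ)⁻¹ ∈ padicIdeal p 1 := by
  obtain ⟨m, rfl⟩ := Nat.exists_eq_succ_of_ne_zero hn
  have h1 : ¬ p ^ (m + 1) ∣ (m + 1)! := by
    rw [padicValNat_dvd_iff_le (Nat.factorial_ne_zero _)]
    have h2 := sub_one_mul_padicValNat_factorial_lt_of_ne_zero (p := p) hn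
    have h3 : 1 ≤ p - 1 := by have := hp.out.two_le; omega
    have h4 := Nat.mul_le_mul_right (padicValNat p (m + 1)!) h3
    rw [one_mul] at h4
    change padicValNat p (m + 1)! ≤ _ at h4
    have h5 := lt_of_le_of_lt h4 h2
    omega
  have h2 : (p : ℚ) ^ (m + 1) ∈ padicIdeal p (m + 1 : ℕ) := by
    exact_mod_cast natCast_mem_padicIdeal_iff (p := p) (t := m + 1) (n := p ^ (m + 1)).2 dvd_rfl
  exact padicIdeal_mul_of_le h2 (inv_natCast_mem_padicIdeal h1) (by push_cast; omega)

theorem expOf_prime_nsmul_mem {g : PowerSeries ℚ} (hg : g ∈ padicSeries p 0)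
    (hg0 : constantCoeff g = 0) : expOf (p • g) - 1 ∈ padicSeries p 1 := fun n => by
  have h0 : constantCoeff (p • g) = 0 := by simp [hg0]
  have hs := HasSubst.of_constantCoeff_zero' h0
  have hfin : (Function.support fun d => coeff d (exp ℚ) • coeff n ((p • g) ^ d)).Finite :=
    coeff_subst_finite' hs (exp ℚ) n
  rw [map_sub, expOf, coeff_subst' hs,
    finsum_eq_sum_of_support_subset (s := insert 0 hfin.toFinset) _ (fun x hx => by
      rw [Finset.coe_insert, Set.Finite.coe_toFinset]; exact Set.mem_insert_of_mem _ hx),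
    ← Finset.add_sum_erase _ _ (Finset.mem_insert_self 0 _)]
  rw [pow_zero, coeff_exp, Nat.factorial_zero, Nat.cast_one, div_one, map_one, one_smul,
    add_sub_cancel_left]
  refine sum_mem fun d hd => ?_
  have hd0 : d ≠ 0 := (Finset.mem_erase.1 hd).1
  have h1 : coeff d (exp ℚ) • coeff n ((p • g) ^ d) =
      (p : ℚ) ^ d * ((d ! : ℕ) : ℚ)⁻¹ * coeff n (g ^ d) := by
    rw [coeff_exp, smul_pow, ← Nat.cast_pow, nsmul_eq_mul, ← nsmul_eq_mul, map_nsmul, nsmul_eq_mul,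
      smul_eq_mul, Algebra.algebraMap_self, RingHom.id_apply, one_div, Nat.cast_pow]
    ring
  rw [h1]
  exact padicIdeal_mul_of_le (prime_pow_div_factorial_mem hd0) (padicSeries_pow hg d n) (by simp)

/-- With `p g = h(z^p) - p h(z)` one has `exp(h)(z^p) = exp(h)^p * exp(p g)`, and `exp(p g)` is `1`
mod `p`, so the Dieudonné-Dwork lemma applies. -/
theorem expOf_mem_padicSeries {h : PowerSeries ℚ} (h0 : constantCoeff h = 0)
    (hh : expand p hp.out.ne_zero h - p • h ∈ padicSeries p 1) : expOf h ∈ padicSeries p 0 := by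
  have hp0 := (prime_pos_rat (p := p)).ne'
  set g : PowerSeries ℚ := (p : ℚ)⁻¹ • (expand p hp.out.ne_zero h - p • h) with hgdef
  have hpg : p • g = expand p hp.out.ne_zero h - p • h := by
    rw [← Nat.cast_smul_eq_nsmul ℚ, hgdef, smul_smul, mul_inv_cancel₀ hp0, one_smul]
  have hg : g ∈ padicSeries p 0 := fun n => by
    have h1 := hh n
    rw [← hpg, map_nsmul, nsmul_eq_mul] at h1
    exact prime_mul_mem_iff.1 (by rwa [zero_add])
  have hg0 : constantCoeff g = 0 := by
    rw [hgdef, ← coeff_zero_eq_constantCoeff_apply, coeff_smul, map_sub, map_nsmul,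
      coeff_zero_eq_constantCoeff_apply, coeff_zero_eq_constantCoeff_apply, constantCoeff_expand, h0]
    simp
  have hpg0 : constantCoeff (p • g) = 0 := by simp [hg0]
  refine mem_padicSeries_of_expand_eq (constantCoeff_expOf h0) (constantCoeff_expOf hpg0)
    (expOf_prime_nsmul_mem hg hg0) ?_
  rw [← expOf_nsmul h0, ← expOf_add (by simp [h0]) hpg0, hpg, add_sub_cancel]
  exact expand_subst _ _ (HasSubst.of_constantCoeff_zero' h0) _

end

/-! ### Local to global, and from the `q_L` to `q` -/

theorem isIntSeries_iff {h : PowerSeries ℚ} :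
    IsIntSeries h ↔ ∀ (p : ℕ) (_ : Fact p.Prime), h ∈ padicSeries p 0 := by
  constructor
  · rintro ⟨g, rfl⟩ p _ n
    rw [coeff_map]
    exact intCast_mem_padicIdeal _
  · intro hh
    have hlift : ∀ n, ∃ z : ℤ, (z : ℚ) = coeff n h :=
      fun n => exists_int_of_forall_padicIdeal fun p hp => hh p hp n
    choose y hy using hlift
    refine ⟨PowerSeries.mk y, ?_⟩
    ext n
    rw [coeff_map, PowerSeries.coeff_mk]
    exact hy n

section

variable {r s : ℕ} {e : Fin r → ℕ} {f : Fin s → ℕ}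

theorem constantCoeff_seriesF : constantCoeff (seriesF e f) = 1 := by
  rw [← coeff_zero_eq_constantCoeff_apply]
  simp [seriesF, factorialRatio]

theorem constantCoeff_seriesGL (L : ℕ) :
    constantCoeff (seriesGL e f L * (seriesF e f)⁻¹) = 0 := by
  rw [map_mul, ← coeff_zero_eq_constantCoeff_apply (seriesGL e f L)]
  simp [seriesGL]

theorem constantCoeff_seriesG : constantCoeff (seriesG e f * (seriesF e f)⁻¹) = 0 := by
  rw [map_mul, ← coeff_zero_eq_constantCoeff_apply (seriesG e f)]
  simp [seriesG]

theorem seriesG_add_sum : seriesG e f + ∑ j, f j • seriesGL e f (f j) =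
    ∑ i, e i • seriesGL e f (e i) := by
  ext n
  simp only [map_add, map_sum, map_nsmul, seriesG, seriesGL, coeff_mk]
  simp only [nsmul_eq_mul]
  have h1 : ∀ {a : ℕ} (c : Fin a → ℕ), ∑ i, (c i : ℚ) * (factorialRatio e f n * harmonic (c i * n)) =
      factorialRatio e f n * ∑ i, (c i : ℚ) * harmonic (c i * n) := by
    intro a c
    rw [Finset.mul_sum]
    exact Finset.sum_congr rfl fun i _ => by ring
  rw [h1, h1]
  ring

theorem expOf_seriesG_mul_prod :
    expOf (seriesG e f * (seriesF e f)⁻¹) * ∏ j, canonicalCoordL e f (f j) ^ f j =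
      ∏ i, canonicalCoordL e f (e i) ^ e i := by
  have h1 : ∀ {a : ℕ} (c : Fin a → ℕ), ∏ i, canonicalCoordL e f (c i) ^ c i =
      expOf (∑ i, c i • (seriesGL e f (c i) * (seriesF e f)⁻¹)) := by
    intro a c
    rw [expOf_sum]
    · exact Finset.prod_congr rfl fun i _ => (expOf_nsmul (constantCoeff_seriesGL _) _).symm
    · intro i _
      rw [map_nsmul, constantCoeff_seriesGL, smul_zero]
  rw [h1, h1, ← expOf_add constantCoeff_seriesG]
  · congr 1
    have h2 := congrArg (· * (seriesF e f)⁻¹) (seriesG_add_sum (e := e) (f := f))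
    simp only [add_mul, Finset.sum_mul, smul_mul_assoc] at h2
    exact h2
  · rw [map_sum]
    refine Finset.sum_eq_zero fun i _ => ?_
    rw [map_nsmul, constantCoeff_seriesGL, smul_zero]

/-- By `expOf_seriesG_mul_prod`, `q / z` is a quotient of products of powers of the `q_L`. The
denominator has constant term `1`, so its inverse is integral too. -/
theorem isXMulIntSeries_canonicalCoord (he : ∀ i, 0 < e i) (hf : ∀ j, 0 < f j)
    (h : ∀ L ∈ Finset.Icc 1 (maxTerm e f), IsIntSeries (canonicalCoordL e f L)) :
    IsXMulIntSeries (canonicalCoord e f) := by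
  have hint : IsIntSeries (expOf (seriesG e f * (seriesF e f)⁻¹)) := by
    rw [isIntSeries_iff]
    intro p hp
    have h1 : ∏ i, canonicalCoordL e f (e i) ^ e i ∈ padicSeries p 0 :=
      padicSeries_prod _ _ fun i _ => padicSeries_pow (isIntSeries_iff.1
        (h _ (Finset.mem_Icc.2 ⟨he i, le_maxTerm_left i⟩)) p hp) _
    have h2 : ∏ j, canonicalCoordL e f (f j) ^ f j ∈ padicSeries p 0 :=
      padicSeries_prod _ _ fun j _ => padicSeries_pow (isIntSeries_iff.1
        (h _ (Finset.mem_Icc.2 ⟨hf j, le_maxTerm_right j⟩)) p hp) _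
    have h3 : constantCoeff (∏ j, canonicalCoordL e f (f j) ^ f j) = 1 := by
      rw [map_prod]
      refine Finset.prod_eq_one fun j _ => ?_
      rw [map_pow, canonicalCoordL, constantCoeff_expOf (constantCoeff_seriesGL _), one_pow]
    have h4 : expOf (seriesG e f * (seriesF e f)⁻¹) =
        (∏ i, canonicalCoordL e f (e i) ^ e i) * (∏ j, canonicalCoordL e f (f j) ^ f j)⁻¹ := by
      rw [← expOf_seriesG_mul_prod, mul_assoc, PowerSeries.mul_inv_cancel _ (by rw [h3]; simp),
        mul_one]
    rw [h4]
    exact padicSeries_mul_zero h1 (padicSeries_inv h2 h3)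
  obtain ⟨g, hg⟩ := hint
  exact ⟨g, by rw [hg, canonicalCoord]⟩

end

/-! ### Case (i): integrality of `q_L` -/

section

variable {p : ℕ} [hp : Fact p.Prime] {r s : ℕ} {e : Fin r → ℕ} {f : Fin s → ℕ}

theorem coeff_mul_expand {a : ℕ} (ha : a < p) (K : ℕ) (g h : PowerSeries ℚ) :
    coeff (a + p * K) (g * expand p hp.out.ne_zero h) =
      ∑ k ∈ Finset.range (K + 1), coeff (a + p * k) g * coeff (K - k) h := by
  rw [coeff_mul]
  symm
  refine Finset.sum_of_injOn (fun k => (a + p * k, p * (K - k))) ?_ ?_ ?_ ?_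
  · intro k _ k' _ hkk
    have h1 := (Prod.mk.inj hkk).1
    exact Nat.eq_of_mul_eq_mul_left hp.out.pos (by omega)
  · intro k hk
    have hk' : k < K + 1 := Finset.mem_range.1 hk
    rw [Finset.mem_coe, Finset.HasAntidiagonal.mem_antidiagonal]
    change a + p * k + p * (K - k) = _
    rw [add_assoc, ← mul_add]
    congr 2
    omega
  · rintro ⟨i, j⟩ hij hni
    rw [Finset.HasAntidiagonal.mem_antidiagonal] at hij
    change i + j = _ at hij
    by_cases hd : p ∣ j
    · exfalso
      obtain ⟨m, rfl⟩ := hd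
      apply hni
      have hm : m ≤ K := by
        have h1 : p * m < p * (K + 1) := by rw [mul_add]; omega
        have := lt_of_mul_lt_mul_left h1 (Nat.zero_le _)
        omega
      obtain ⟨k, rfl⟩ := Nat.exists_eq_add_of_le' hm
      refine ⟨k, Finset.mem_coe.2 (Finset.mem_range.2 (by omega)), ?_⟩
      refine Prod.ext ?_ ?_
      · change a + p * k = i
        rw [mul_add] at hij
        omega
      · change p * (k + m - k) = p * m
        rw [Nat.add_sub_cancel_left]
    · rw [coeff_expand_of_not_dvd _ _ _ hd, mul_zero]
  · intro k _
    rw [coeff_expand_mul]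

/-- `h(z^p) - p h(z)`, for `h = G / F`, is `F(z) G(z^p) - p G(z) F(z^p)` divided by the `p`-integral
unit `F(z) F(z^p)`. The coefficient of the numerator at `n` is the sum of `sum_mul_harmonic_mem`
with `a = n % p` and `K = n / p`. -/
theorem IsDworkSequence.canonicalCoordL_mem {M L : ℕ} (hA : IsDworkSequence p M (factorialRatio e f))
    (hL : L ≤ M) : canonicalCoordL e f L ∈ padicSeries p 0 := by
  have hF : seriesF e f ∈ padicSeries p 0 := fun n => by
    rw [seriesF, coeff_mk]
    exact hA.mem_zero n
  set F := seriesF e f with hFdef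
  set G := seriesGL e f L with hGdef
  set E := expand p hp.out.ne_zero (R := ℚ) with hEdef
  have hF1 : constantCoeff F = 1 := constantCoeff_seriesF
  have hEF1 : constantCoeff (E F) = 1 := by rw [hEdef, constantCoeff_expand, hF1]
  have hFF : F * F⁻¹ = 1 := seriesF_mul_inv e f
  have hEE : E F * (E F)⁻¹ = 1 := PowerSeries.mul_inv_cancel _ (by rw [hEF1]; simp)
  have key : F * E G - p • (G * E F) ∈ padicSeries p 1 := fun n => by
    have h1 := hA.sum_mul_harmonic_mem (Nat.mod_lt n hp.out.pos) hL (n / p)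
    have h2 : coeff n (F * E G - p • (G * E F)) =
        ∑ j ∈ Finset.range (n / p + 1), factorialRatio e f (n % p + p * j) *
          factorialRatio e f (n / p - j) *
          (harmonic (L * (n / p - j)) - p * harmonic (L * (n % p + p * j))) := by
      conv_lhs => rw [← Nat.mod_add_div n p]
      rw [map_sub, map_nsmul, hEdef, coeff_mul_expand (Nat.mod_lt n hp.out.pos),
        coeff_mul_expand (Nat.mod_lt n hp.out.pos), nsmul_eq_mul, Finset.mul_sum,
        ← Finset.sum_sub_distrib]
      refine Finset.sum_congr rfl fun j _ => ?_
      rw [hFdef, hGdef, seriesF, seriesGL, coeff_mk, coeff_mk, coeff_mk, coeff_mk]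
      ring
    rw [h2]
    exact h1
  refine expOf_mem_padicSeries (constantCoeff_seriesGL L) ?_
  have hEinv : E (F⁻¹) = (E F)⁻¹ := by
    have h1 : E F * E F⁻¹ = 1 := by rw [← map_mul, hFF, map_one]
    calc E F⁻¹ = E F⁻¹ * (E F * (E F)⁻¹) := by rw [hEE, mul_one]
      _ = (E F * E F⁻¹) * (E F)⁻¹ := by ring
      _ = _ := by rw [h1, one_mul]
  have h1 : E (G * F⁻¹) - p • (G * F⁻¹) = F⁻¹ * ((E F)⁻¹ * (F * E G - p • (G * E F))) := by
    rw [map_mul, hEinv, nsmul_eq_mul, nsmul_eq_mul]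
    linear_combination (-(E G) * (E F)⁻¹) * hFF + (p * G * F⁻¹) * hEE
  rw [h1]
  exact padicSeries_mul_zero (padicSeries_inv hF hF1)
    (padicSeries_mul_zero (padicSeries_inv (expand_mem_padicSeries hF) hEF1) key)

theorem isIntSeries_canonicalCoordL (hsum : ∑ i, e i = ∑ j, f j) (hM : 0 < maxTerm e f)
    (hΔ : ∀ n q, 0 < q → q ≤ maxTerm e f * (n % q) → 1 ≤ floorDiff e f n q) {L : ℕ}
    (hL : L ≤ maxTerm e f) : IsIntSeries (canonicalCoordL e f L) :=
  isIntSeries_iff.2 fun _ _ =>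
    (isDworkSequence_factorialRatio hsum hM hΔ).canonicalCoordL_mem hL

end

/-! ### Values and jumps of `Δ`; the Abel summation argument -/

section

variable {r s : ℕ} {e : Fin r → ℕ} {f : Fin s → ℕ}

/-- Since `c ∣ D`, the function `n ↦ ⌊c n / D⌋` jumps exactly at `n = (D / c) (k + 1)`, where `log
(n + D) - log n` equals `log (c + k + 1) - log (k + 1)`. -/
theorem sum_log_eq_sum_jump {c D : ℕ} (hD : 0 < D) (hc : c ∣ D) (N : ℕ) :
    ∑ k ∈ Finset.range (c * N / D), (Real.log (c + k + 1) - Real.log (k + 1)) =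
      ∑ n ∈ Finset.range N, (((c * (n + 1) / D : ℕ) : ℝ) - ((c * n / D : ℕ) : ℝ)) *
        (Real.log ((n + 1 : ℕ) + D) - Real.log (n + 1 : ℕ)) := by
  obtain ⟨d, rfl⟩ := hc
  have hc0 : 0 < c := Nat.pos_of_mul_pos_right hD
  have hd0 : 0 < d := Nat.pos_of_mul_pos_left hD
  simp only [Nat.mul_div_mul_left _ _ hc0]
  induction N with
  | zero => simp
  | succ N ih =>
    rw [Finset.sum_range_succ, ← ih, Nat.succ_div]
    split_ifs with h
    · have h1 : N + 1 = d * (N / d + 1) := by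
        have := Nat.div_mul_cancel h
        rw [Nat.succ_div, if_pos h] at this
        rw [mul_comm]; exact this.symm
      have h2 : ((N + 1 : ℕ) : ℝ) = d * ((N / d : ℕ) + 1) := by
        rw [h1]; push_cast; rfl
      have h3 : (d : ℝ) * ((N / d : ℕ) + 1) + (c * d : ℕ) = d * (c + (N / d : ℕ) + 1) := by
        push_cast; ring
      rw [Finset.sum_range_succ, h2, h3, Real.log_mul (by positivity) (by positivity),
        Real.log_mul (by positivity) (by positivity)]
      push_cast
      ring
    · simp

theorem sum_jump_eq (a b : ℕ → ℝ) (N : ℕ) (h0 : a 0 = 0) (hN : a N = 0) :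
    ∑ n ∈ Finset.range N, (a (n + 1) - a n) * b (n + 1) =
      ∑ n ∈ Finset.range N, a n * (b n - b (n + 1)) := by
  have h1 := Finset.sum_range_sub (fun n => a n * b n) N
  simp only [h0, hN, zero_mul, sub_self] at h1
  rw [← sub_eq_zero, ← Finset.sum_sub_distrib, ← h1]
  exact Finset.sum_congr rfl fun n _ => by ring

/-- Abel summation shows that the ratio jumps when `Δ` is nonnegative, not identically zero, and
returns to zero at `N / D`. -/
theorem shiftRatio_one_ne_zero {D N n₀ : ℕ} (hD : 0 < D) (he : ∀ i, e i ∣ D) (hf : ∀ j, f j ∣ D)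
    (hnn : ∀ n, 0 ≤ floorDiff e f n D) (hn₀ : 0 < n₀) (hn₀N : n₀ < N)
    (hpos : 0 < floorDiff e f n₀ D) (hN : floorDiff e f N D = 0) :
    shiftRatio e f (fun i => e i * N / D) (fun j => f j * N / D) 1 ≠
      shiftRatio e f (fun i => e i * N / D) (fun j => f j * N / D) 0 := by
  intro heq
  -- Taking logarithms, equality of the two ratios says that the jumps of `Δ` weighted by `ψ` sum to
  -- `0`. Abel summation moves the differences to `ψ`, which strictly decreases on `n > 0`.
  set ψ : ℕ → ℝ := fun n => Real.log ((n : ℕ) + D) - Real.log (n : ℕ) with hψ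
  have key : ∀ {m : ℕ} (c : Fin m → ℕ),
      Real.log (∏ i, ∏ k ∈ Finset.range (c i * N / D), ((c i * 1 + k + 1 : ℕ) : ℝ)) -
      Real.log (∏ i, ∏ k ∈ Finset.range (c i * N / D), ((c i * 0 + k + 1 : ℕ) : ℝ)) =
      ∑ i, ∑ k ∈ Finset.range (c i * N / D), (Real.log (c i + k + 1) - Real.log (k + 1)) := by
    intro m c
    have hlog : ∀ u : ℕ, Real.log (∏ i, ∏ k ∈ Finset.range (c i * N / D),
        ((c i * u + k + 1 : ℕ) : ℝ)) =
        ∑ i, ∑ k ∈ Finset.range (c i * N / D), Real.log ((c i * u + k + 1 : ℕ) : ℝ) := by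
      intro u
      rw [Real.log_prod]
      · refine Finset.sum_congr rfl fun i _ => ?_
        rw [Real.log_prod]
        exact fun k _ => by positivity
      · exact fun i _ => Finset.prod_ne_zero_iff.2 fun k _ => by positivity
    rw [hlog, hlog, ← Finset.sum_sub_distrib]
    refine Finset.sum_congr rfl fun i _ => ?_
    rw [← Finset.sum_sub_distrib]
    refine Finset.sum_congr rfl fun k _ => ?_
    push_cast
    simp
  have hpos' : ∀ {m : ℕ} (c : Fin m → ℕ) (u : ℕ),
      (∏ i, ∏ k ∈ Finset.range (c i * N / D), ((c i * u + k + 1 : ℕ) : ℝ)) ≠ 0 := fun c u =>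
    Finset.prod_ne_zero_iff.2 fun i _ => Finset.prod_ne_zero_iff.2 fun k _ => by positivity
  have h1 : (∑ i, ∑ k ∈ Finset.range (e i * N / D), (Real.log (e i + k + 1) - Real.log (k + 1))) -
      ∑ j, ∑ k ∈ Finset.range (f j * N / D), (Real.log (f j + k + 1) - Real.log (k + 1)) = 0 := by
    rw [← key e, ← key f]
    have h2 := congrArg (fun x : ℚ => Real.log (x : ℝ)) heq
    simp only [shiftRatio, Rat.cast_div, Rat.cast_prod, Rat.cast_natCast] at h2
    rw [Real.log_div (hpos' e 1) (hpos' f 1), Real.log_div (hpos' e 0) (hpos' f 0)] at h2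
    linarith
  have h2 : ∑ n ∈ Finset.range N, ((floorDiff e f (n + 1) D : ℝ) - (floorDiff e f n D : ℝ)) *
      ψ (n + 1) = 0 := by
    rw [← h1]
    simp only [sum_log_eq_sum_jump hD (he _), sum_log_eq_sum_jump hD (hf _)]
    rw [Finset.sum_comm, Finset.sum_comm (s := Finset.univ) (γ := Fin s), ← Finset.sum_sub_distrib]
    refine Finset.sum_congr rfl fun n _ => ?_
    rw [← Finset.sum_mul, ← Finset.sum_mul, ← sub_mul, hψ, floorDiff, floorDiff]
    congr 1
    simp only [Int.cast_sub, Int.cast_sum, Int.cast_natCast, Finset.sum_sub_distrib]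
    ring
  have h0 : floorDiff e f 0 D = 0 := by simp [floorDiff]
  rw [sum_jump_eq (fun n => (floorDiff e f n D : ℝ)) ψ N (by simp [h0]) (by simp [hN])] at h2
  have hlt : ∀ n, 0 < n → ψ (n + 1) < ψ n := by
    intro n hn
    have hn' : (0 : ℝ) < n := by exact_mod_cast hn
    have hD' : (0 : ℝ) < D := by exact_mod_cast hD
    have h3 : Real.log (((n + 1 : ℕ) : ℝ) + D) + Real.log n <
        Real.log ((n : ℝ) + D) + Real.log ((n + 1 : ℕ) : ℝ) := by
      rw [← Real.log_mul (by positivity) (by positivity),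
        ← Real.log_mul (by positivity) (by positivity)]
      refine Real.log_lt_log (by positivity) ?_
      push_cast
      nlinarith
    simp only [hψ]
    linarith
  have h3 : 0 < ∑ n ∈ Finset.range N, (floorDiff e f n D : ℝ) * (ψ n - ψ (n + 1)) := by
    refine Finset.sum_pos' (fun n _ => ?_) ⟨n₀, Finset.mem_range.2 hn₀N, ?_⟩
    -- At `n = 0` the value of `ψ` relies on the convention `Real.log 0 = 0`, but it is multiplied
    -- by `Δ(0) = 0`.
    · rcases Nat.eq_zero_or_pos n with rfl | hn
      · simp [h0]
      · exact mul_nonneg (by exact_mod_cast hnn n) (sub_nonneg.2 (hlt n hn).le)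
    · exact mul_pos (by exact_mod_cast hpos) (sub_pos.2 (hlt n₀ hn₀))
  exact h3.ne' h2

/-- `⌈x p⌉ / p` tends to `x` from above and the floor function is right-continuous. Only finitely
many `c` occur, so one bound serves them all. -/
theorem exists_forall_mul_ceil_div {x : ℝ} (hx : 0 ≤ x) (B : ℕ) :
    ∃ N : ℕ, ∀ p, N < p → ∀ c ≤ B, c * ⌈x * p⌉₊ / p = ⌊(c : ℝ) * x⌋₊ := by
  have key : ∀ c : ℕ, ∃ N : ℕ, ∀ p, N < p → c * ⌈x * p⌉₊ / p = ⌊(c : ℝ) * x⌋₊ := by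
    intro c
    set E := ⌊(c : ℝ) * x⌋₊ with hE
    have hE1 : (E : ℝ) ≤ c * x := Nat.floor_le (by positivity)
    have hE2 : (c : ℝ) * x < E + 1 := Nat.lt_floor_add_one _
    refine ⟨⌈c / (E + 1 - c * x)⌉₊, fun p hp => ?_⟩
    have hp0 : 0 < p := by omega
    have hp0' : (0 : ℝ) < p := by exact_mod_cast hp0
    have hp1 : c / (E + 1 - c * x) < (p : ℝ) := (Nat.le_ceil _).trans_lt (by exact_mod_cast hp)
    rw [div_lt_iff₀ (by linarith)] at hp1
    have h1 : x * p ≤ ⌈x * p⌉₊ := Nat.le_ceil _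
    have h2 : (⌈x * p⌉₊ : ℝ) < x * p + 1 := Nat.ceil_lt_add_one (by positivity)
    refine Nat.div_eq_of_lt_le ?_ ?_
    · have : (E : ℝ) * p ≤ c * ⌈x * p⌉₊ := by
        calc (E : ℝ) * p ≤ c * x * p := mul_le_mul_of_nonneg_right hE1 hp0'.le
          _ = c * (x * p) := by ring
          _ ≤ _ := mul_le_mul_of_nonneg_left h1 (Nat.cast_nonneg c)
      exact_mod_cast this
    · have : (c : ℝ) * ⌈x * p⌉₊ < (E + 1) * p := by
        have := mul_le_mul_of_nonneg_left h2.le (Nat.cast_nonneg (α := ℝ) c)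
        nlinarith
      exact_mod_cast this
  choose N hN using key
  refine ⟨(Finset.range (B + 1)).sup N, fun p hp c hc => hN c p (lt_of_le_of_lt ?_ hp)⟩
  exact Finset.le_sup (f := N) (Finset.mem_range.2 (Nat.lt_succ_of_le hc))

theorem landau_eq_natFloor {x : ℝ} (hx : 0 ≤ x) :
    landau e f x = ∑ i, ((⌊(e i : ℝ) * x⌋₊ : ℕ) : ℤ) - ∑ j, ((⌊(f j : ℝ) * x⌋₊ : ℕ) : ℤ) := by
  have h : ∀ c : ℕ, ⌊(c : ℝ) * x⌋ = ((⌊(c : ℝ) * x⌋₊ : ℕ) : ℤ) := fun c =>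
    (Int.natCast_floor_eq_floor (by positivity)).symm
  simp only [landau, h]

theorem floorDiff_eq_landau (n q : ℕ) : floorDiff e f n q = landau e f ((n : ℝ) / q) := by
  have h : ∀ c : ℕ, ((c * n / q : ℕ) : ℤ) = ((⌊(c : ℝ) * ((n : ℝ) / q)⌋₊ : ℕ) : ℤ) := by
    intro c
    rw [← mul_div_assoc, ← Nat.cast_mul, Nat.floor_div_eq_div]
  rw [landau_eq_natFloor (by positivity)]
  simp only [floorDiff, h]

/-- For large `p` the integer `a = ⌈x p⌉` satisfies `⌊c a / p⌋ = ⌊c x⌋` for all `c ≤ M`, hence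
`Δ(a / p) = Δ(x)`. -/
theorem exists_forall_floorDiff_ceil {x : ℝ} (hx : 0 ≤ x) :
    ∃ N : ℕ, ∀ p, N < p → (∀ c ≤ maxTerm e f, c * ⌈x * p⌉₊ / p = ⌊(c : ℝ) * x⌋₊) ∧
      floorDiff e f ⌈x * p⌉₊ p = landau e f x := by
  obtain ⟨N, hN⟩ := exists_forall_mul_ceil_div hx (maxTerm e f)
  refine ⟨N, fun p hp => ⟨hN p hp, ?_⟩⟩
  rw [landau_eq_natFloor hx, floorDiff]
  simp only [hN p hp _ (le_maxTerm_left _), hN p hp _ (le_maxTerm_right _)]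

theorem factorialRatio_eq {p : ℕ} [Fact p.Prime] (hsum : ∑ i, e i = ∑ j, f j) (a : ℕ) :
    factorialRatio e f a = unitRatio p e f a * (p : ℚ) ^ floorDiff e f a p *
      shiftRatio e f (fun i => e i * a / p) (fun j => f j * a / p) 0 := by
  have h := factorialRatio_add_mul (p := p) hsum 0 a
  rwa [mul_zero, add_zero, factorialRatio_zero, one_mul] at h

/-- **Landau's criterion**, necessity. -/
theorem landau_nonneg (hsum : ∑ i, e i = ∑ j, f j)
    (hint : ∀ n : ℕ, ∃ k : ℤ, factorialRatio e f n = (k : ℚ)) {x : ℝ} (hx : 0 ≤ x) :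
    0 ≤ landau e f x := by
  obtain ⟨N₁, hN₁⟩ := exists_forall_floorDiff_ceil (e := e) (f := f) hx
  obtain ⟨N₂, hN₂⟩ := exists_forall_padicNorm_eq_one (shiftRatio_ne_zero (e := e) (f := f)
    (E := fun i => ⌊(e i : ℝ) * x⌋₊) (F := fun j => ⌊(f j : ℝ) * x⌋₊) 0)
  obtain ⟨p, hp, hpp⟩ := Nat.exists_infinite_primes (N₁ + N₂ + 1)
  have : Fact p.Prime := ⟨hpp⟩
  obtain ⟨h1, h2⟩ := hN₁ p (by omega)
  -- For this large `p`, the valuation of the integer `Q(⌈x p⌉)` is exactly `Δ(x)`.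
  have h3 := factorialRatio_eq (p := p) hsum ⌈x * p⌉₊
  simp only [h1 _ (le_maxTerm_left _), h1 _ (le_maxTerm_right _), h2] at h3
  obtain ⟨k, hk⟩ := hint ⌈x * p⌉₊
  have h4 := padicNorm.of_int (p := p) k
  rw [← hk, h3, padicNorm.mul, padicNorm.mul, padicNorm_unitRatio, hN₂ p this (by omega), one_mul,
    mul_one, padicNorm.eq_zpow_of_nonzero (zpow_ne_zero _ (prime_pos_rat (p := p)).ne'),
    padicValRat.zpow, padicValRat.self hpp.one_lt, mul_one, ← zpow_zero (p : ℚ),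
    zpow_le_zpow_iff_right₀ one_lt_prime_rat] at h4
  omega

/-- `Δ` jumps up at `1 / M`. -/
theorem floorDiff_maxTerm_pos (hsum : ∑ i, e i = ∑ j, f j)
    (he : ∀ i, 0 < e i) (hf : ∀ j, 0 < f j)
    (hint : ∀ n : ℕ, ∃ k : ℤ, factorialRatio e f n = (k : ℚ)) (hdisj : ∀ i j, e i ≠ f j)
    (hM : 0 < maxTerm e f) {d : ℕ} (hd : 0 < d) : 0 < floorDiff e f d (maxTerm e f * d) := by
  have hnn : 0 ≤ floorDiff e f d (maxTerm e f * d) := by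
    rw [floorDiff_eq_landau]
    exact landau_nonneg hsum hint (by positivity)
  set M := maxTerm e f with hMdef
  have h1 : ∀ c ≤ M, 0 < c → c * d / (M * d) = if c = M then 1 else 0 := by
    intro c hc hc0
    rw [Nat.mul_div_mul_right _ _ hd]
    split_ifs with h
    · rw [h, Nat.div_self hM]
    · exact Nat.div_eq_of_lt (lt_of_le_of_ne hc h)
  have h2 : floorDiff e f d (M * d) =
      ∑ i, (if e i = M then (1 : ℤ) else 0) - ∑ j, (if f j = M then (1 : ℤ) else 0) := by
    rw [floorDiff]
    congr 1 <;> refine Finset.sum_congr rfl fun i _ => ?_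
    · rw [h1 _ (le_maxTerm_left i) (he i)]; split_ifs <;> rfl
    · rw [h1 _ (le_maxTerm_right i) (hf i)]; split_ifs <;> rfl
  have hex : (∃ i, e i = M) ∨ ∃ j, f j = M := by
    by_contra hcon
    push Not at hcon
    have h3 : Finset.univ.sup e < M := (Finset.sup_lt_iff hM).2 fun i _ =>
      lt_of_le_of_ne (le_maxTerm_left i) (hcon.1 i)
    have h4 : Finset.univ.sup f < M := (Finset.sup_lt_iff hM).2 fun j _ =>
      lt_of_le_of_ne (le_maxTerm_right j) (hcon.2 j)
    exact (max_lt h3 h4).ne hMdef.symm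
  rw [h2] at hnn ⊢
  rcases hex with ⟨i, hi⟩ | ⟨j, hj⟩
  · have h3 : ∑ j, (if f j = M then (1 : ℤ) else 0) = 0 :=
      Finset.sum_eq_zero fun j _ => if_neg fun h => hdisj i j (hi.trans h.symm)
    rw [h3, sub_zero]
    refine Finset.sum_pos' (fun k _ => by split_ifs <;> simp) ⟨i, Finset.mem_univ i, ?_⟩
    rw [if_pos hi]; exact one_pos
  -- If `M` were one of the `f j`, then by disjointness `Δ(1/M)` would be negative.
  · exfalso
    have h3 : ∑ i, (if e i = M then (1 : ℤ) else 0) = 0 :=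
      Finset.sum_eq_zero fun i _ => if_neg fun h => hdisj i j (h.trans hj.symm)
    have h4 : 0 < ∑ j, (if f j = M then (1 : ℤ) else 0) := by
      refine Finset.sum_pos' (fun k _ => by split_ifs <;> simp) ⟨j, Finset.mem_univ j, ?_⟩
      rw [if_pos hj]; exact one_pos
    omega

end

/-! ### Case (ii): consequences of `p`-integrality of `q_L` -/

section

variable {p : ℕ} [hp : Fact p.Prime] {r s : ℕ} {e : Fin r → ℕ} {f : Fin s → ℕ}

theorem unit_not_mem_padicIdeal {x : ℚ} (hx : padicNorm p x = 1) : x ∉ padicIdeal p 1 := by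
  intro h
  rw [mem_padicIdeal, hx, ← zpow_zero (p : ℚ), zpow_le_zpow_iff_right₀ one_lt_prime_rat] at h
  omega

/-- The numbers `n * coeff n h` are the coefficients of the logarithmic derivative `z q' / q` of `q
= exp h`. -/
theorem natCast_mul_coeff_mem {h : PowerSeries ℚ} (h0 : constantCoeff h = 0)
    (hh : expOf h ∈ padicSeries p 0) (n : ℕ) : (n : ℚ) * coeff n h ∈ padicIdeal p 0 := by
  rcases n with _ | n
  · simp
  have h1 : constantCoeff (expOf h) = 1 := constantCoeff_expOf h0
  have h2 : derivative ℚ h = (expOf h)⁻¹ * derivative ℚ (expOf h) := by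
    rw [derivative_expOf h0, ← mul_assoc, PowerSeries.inv_mul_cancel _ (by rw [h1]; simp), one_mul]
  have h3 : derivative ℚ (expOf h) ∈ padicSeries p 0 := fun m => by
    rw [coeff_derivative, ← Nat.cast_succ]
    exact padicIdeal_mul_of_le (hh _) (natCast_mem_padicIdeal (m + 1)) (by simp)
  have h4 := padicSeries_mul_zero (padicSeries_inv hh h1) h3
  rw [← h2] at h4
  have h5 := h4 n
  rw [coeff_derivative] at h5
  rw [mul_comm]
  exact_mod_cast h5

theorem coeff_mem_of_not_dvd {h : PowerSeries ℚ} (h0 : constantCoeff h = 0)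
    (hh : expOf h ∈ padicSeries p 0) {n : ℕ} (hn : ¬ p ∣ n) : coeff n h ∈ padicIdeal p 0 :=
  (unit_mul_mem_iff ((padicNorm.nat_eq_one_iff n).2 hn)).1 (natCast_mul_coeff_mem h0 hh n)

/-- Below degree `2 p`, the only coefficient of `h` that may fail to be `p`-integral is the one at
`p`; its contribution is subtracted. -/
theorem coeff_mul_sub_mem {h F : PowerSeries ℚ} (h0 : constantCoeff h = 0)
    (hh : expOf h ∈ padicSeries p 0) (hF : F ∈ padicSeries p 0) {n : ℕ} (hn : n < 2 * p) :
    coeff n (h * F) - coeff n (X ^ p * F) * coeff p h ∈ padicIdeal p 0 := by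
  have h1 : coeff n (h * F) - coeff n (X ^ p * F) * coeff p h =
      coeff n ((h - X ^ p * C (coeff p h)) * F) := by
    rw [sub_mul, map_sub, mul_right_comm, coeff_mul_C]
  rw [h1, coeff_mul]
  refine sum_mem fun x hx => ?_
  rw [Finset.HasAntidiagonal.mem_antidiagonal] at hx
  refine padicIdeal_mul_of_le (k := 0) ?_ (hF _) (by simp)
  rw [map_sub, coeff_mul_C, coeff_X_pow]
  split_ifs with hxp
  · rw [hxp, one_mul, sub_self]
    exact AddSubgroup.zero_mem _
  · rw [zero_mul, sub_zero]
    rcases Nat.eq_zero_or_pos x.1 with hx0 | hx0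
    · rw [hx0, coeff_zero_eq_constantCoeff_apply, h0]
      exact AddSubgroup.zero_mem _
    · refine coeff_mem_of_not_dvd h0 hh fun hd => hxp ?_
      obtain ⟨m, hm⟩ := hd
      have h2 : p * m < p * 2 := by omega
      have h3 := lt_of_mul_lt_mul_left h2 (Nat.zero_le _)
      have h4 : m ≠ 0 := by rintro rfl; omega
      have h5 : m = 1 := by omega
      rw [hm, h5, mul_one]

theorem seriesF_mem (hint : ∀ n : ℕ, ∃ k : ℤ, factorialRatio e f n = (k : ℚ)) :
    seriesF e f ∈ padicSeries p 0 := fun n => by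
  rw [seriesF, coeff_mk]
  obtain ⟨k, hk⟩ := hint n
  rw [hk]
  exact intCast_mem_padicIdeal k

theorem seriesGL_eq_mul (L : ℕ) :
    seriesGL e f L * (seriesF e f)⁻¹ * seriesF e f = seriesGL e f L := by
  rw [mul_assoc, mul_comm _ (seriesF e f), seriesF_mul_inv, mul_one]

theorem factorialRatio_mul_harmonic_mem
    (hint : ∀ n : ℕ, ∃ k : ℤ, factorialRatio e f n = (k : ℚ)) {L : ℕ}
    (hq : canonicalCoordL e f L ∈ padicSeries p 0) {a : ℕ} (ha : a < p) :
    factorialRatio e f a * harmonic (L * a) ∈ padicIdeal p 0 := by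
  have h1 := coeff_mul_sub_mem (constantCoeff_seriesGL L) hq (seriesF_mem hint)
    (show a < 2 * p by omega)
  rw [seriesGL_eq_mul, coeff_X_pow_mul', if_neg (by omega), zero_mul, sub_zero, seriesGL,
    coeff_mk] at h1
  exact h1

/-- The uncontrolled coefficient of `G_L / F` at `p` is eliminated between degrees `p` and `a + p`.
After multiplication by `p`, both `H_{L(a+p)}` and `H_{Lp}` become `H_L` mod `p`, thanks to `⌊L a /
p⌋ = 0`. -/
theorem harmonic_mul_sub_mem
    (hint : ∀ n : ℕ, ∃ k : ℤ, factorialRatio e f n = (k : ℚ)) {L : ℕ}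
    (hq : canonicalCoordL e f L ∈ padicSeries p 0) {a : ℕ} (ha : a < p) (hLa : L * a / p = 0) :
    harmonic L * (factorialRatio e f (a + p) - factorialRatio e f a * factorialRatio e f p) ∈
      padicIdeal p 1 := by
  set A := factorialRatio e f with hA
  have hA0 : ∀ n, A n ∈ padicIdeal p 0 := fun n => by
    obtain ⟨k, hk⟩ := hint n
    rw [hk]
    exact intCast_mem_padicIdeal k
  have key : ∀ b < p, A (b + p) * harmonic (L * (b + p)) -
      A b * coeff p (seriesGL e f L * (seriesF e f)⁻¹) ∈ padicIdeal p 0 := by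
    intro b hb
    have h1 := coeff_mul_sub_mem (constantCoeff_seriesGL L) hq (seriesF_mem hint)
      (show b + p < 2 * p by omega)
    rw [seriesGL_eq_mul, coeff_X_pow_mul, seriesGL, seriesF, coeff_mk, coeff_mk] at h1
    exact h1
  have h1 := key a ha
  have h2 := key 0 hp.out.pos
  rw [zero_add] at h2
  have h3 : harmonic L * (A (a + p) - A a * A p) =
      p * ((A (a + p) * harmonic (L * (a + p)) -
        A a * coeff p (seriesGL e f L * (seriesF e f)⁻¹)) -
        A a * (A p * harmonic (L * p) -
          A 0 * coeff p (seriesGL e f L * (seriesF e f)⁻¹))) -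
      A (a + p) * (p * harmonic (L * (a + p)) - harmonic (L * (a + p) / p)) +
      A a * A p * (p * harmonic (L * p) - harmonic (L * p / p)) := by
    have h4 : L * (a + p) / p = L := by
      rw [mul_add, Nat.add_mul_div_right _ _ hp.out.pos, hLa, zero_add]
    have h5 : A 0 = 1 := factorialRatio_zero
    rw [h4, Nat.mul_div_cancel _ hp.out.pos, h5]
    ring
  rw [h3]
  refine add_mem (sub_mem ?_ ?_) ?_
  · exact padicIdeal_mul_of_le prime_mem_padicIdeal
      (sub_mem h1 (padicIdeal_mul_of_le (hA0 _) h2 (by simp))) (by simp)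
  · exact padicIdeal_mul_of_le (hA0 _) (prime_mul_harmonic_sub_mem _) (by simp)
  · exact padicIdeal_mul_of_le (k := 0) (padicIdeal_mul_of_le (hA0 _) (hA0 _) (by simp))
      (prime_mul_harmonic_sub_mem _) (by simp)

/-- `Q(a + p)` and `Q(a) Q(p)` share the unit factor `Q(1) * unitRatio p e f a`. What remains is
`P₁` and `P₀`, up to units that are `1` mod `p`. -/
theorem shiftRatio_sub_mem (hsum : ∑ i, e i = ∑ j, f j)
    (hint : ∀ n : ℕ, ∃ k : ℤ, factorialRatio e f n = (k : ℚ)) {L : ℕ}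
    (hq : canonicalCoordL e f L ∈ padicSeries p 0) {a : ℕ} (ha : a < p) (hLa : L * a / p = 0)
    {E : Fin r → ℕ} {F : Fin s → ℕ} (hE : ∀ i, e i * a / p = E i) (hF : ∀ j, f j * a / p = F j)
    (hΔ : floorDiff e f a p = 0) (h0 : padicNorm p (shiftRatio e f E F 0) = 1)
    (h1 : padicNorm p (shiftRatio e f E F 1) = 1) (hL : padicNorm p (harmonic L) = 1)
    (hB : padicNorm p (factorialRatio e f 1) = 1) :
    shiftRatio e f E F 1 - shiftRatio e f E F 0 ∈ padicIdeal p 1 := by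
  have hmem := (unit_mul_mem_iff hL).1 (harmonic_mul_sub_mem hint hq ha hLa)
  have hU : padicNorm p (unitRatio p e f a) = 1 := padicNorm_unitRatio a
  have hU0 := unitRatio_ne_zero (p := p) (e := e) (f := f) a
  have e1 := factorialRatio_eq (p := p) hsum a
  simp only [hE, hF, hΔ, zpow_zero, mul_one] at e1
  have e2 := factorialRatio_add_mul (p := p) hsum 1 a
  simp only [hE, hF, hΔ, zpow_zero, mul_one] at e2
  have e3 := factorialRatio_add_mul (p := p) hsum 1 0
  have e4 : shiftRatio e f (fun i => e i * 0 / p) (fun j => f j * 0 / p) 1 = 1 := by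
    simp [shiftRatio]
  have e5 : floorDiff e f 0 p = 0 := by simp [floorDiff]
  rw [e4, e5, zpow_zero, mul_one, mul_one, mul_one, zero_add] at e3
  have u1 := unitRatio_add_div (p := p) hsum a 1 0
  have u2 := unitRatio_add_div (p := p) hsum 0 1 0
  have e6 : unitRatio p e f 0 = 1 := by simp [unitRatio, unitFactorial]
  rw [e6, div_one, zero_add, one_mul, zero_add, pow_one] at u2
  rw [one_mul, zero_add, pow_one] at u1
  set P₀ := shiftRatio e f E F 0
  set P₁ := shiftRatio e f E F 1
  set U := unitRatio p e f a
  set α := unitRatio p e f (a + p) / U with hα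
  set β := unitRatio p e f p
  have h2 : factorialRatio e f (a + p) - factorialRatio e f a * factorialRatio e f p =
      factorialRatio e f 1 * (U * (α * P₁ - β * P₀)) := by
    rw [e2, e1, e3, hα]
    field_simp
  rw [h2, unit_mul_mem_iff hB, unit_mul_mem_iff hU] at hmem
  have h3 : P₁ - P₀ = (α * P₁ - β * P₀) - P₁ * (α - 1) + P₀ * (β - 1) := by ring
  rw [h3]
  exact add_mem (sub_mem hmem ((unit_mul_mem_iff h1).2 (by exact_mod_cast u1.1)))
    ((unit_mul_mem_iff h0).2 (by exact_mod_cast u2.1))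

end

/-! ### Case (ii): conclusion, and the interval `[1/M, 1[` -/

section

variable {r s : ℕ} {e : Fin r → ℕ} {f : Fin s → ℕ}

/-- Discretises `x` to `N / (M d)`, where `M d` is a common multiple of all terms: rounding down to
this grid leaves every `⌊e_i x⌋` and `⌊f_j x⌋` unchanged. The factor `M` puts `1/M` on the grid as
`d / (M d)`, the point where `Δ` is positive. -/
theorem shiftRatio_floor_one_ne_zero (hsum : ∑ i, e i = ∑ j, f j)
    (he : ∀ i, 0 < e i) (hf : ∀ j, 0 < f j)
    (hint : ∀ n : ℕ, ∃ k : ℤ, factorialRatio e f n = (k : ℚ)) (hdisj : ∀ i j, e i ≠ f j)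
    (hM : 0 < maxTerm e f) {x : ℝ} (hx : 1 / (maxTerm e f : ℝ) ≤ x) (hx0 : landau e f x = 0) :
    shiftRatio e f (fun i => ⌊(e i : ℝ) * x⌋₊) (fun j => ⌊(f j : ℝ) * x⌋₊) 1 ≠
      shiftRatio e f (fun i => ⌊(e i : ℝ) * x⌋₊) (fun j => ⌊(f j : ℝ) * x⌋₊) 0 := by
  set M := maxTerm e f with hMdef
  have hM' : (0 : ℝ) < M := by exact_mod_cast hM
  have hxpos : 0 ≤ x := le_trans (by positivity) hx
  set d := (∏ i, e i) * ∏ j, f j with hd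
  have hd0 : 0 < d :=
    Nat.mul_pos (Finset.prod_pos fun i _ => he i) (Finset.prod_pos fun j _ => hf j)
  have hed : ∀ i, e i ∣ M * d := fun i =>
    ((Finset.dvd_prod_of_mem e (Finset.mem_univ i)).mul_right _).mul_left _
  have hfd : ∀ j, f j ∣ M * d := fun j =>
    ((Finset.dvd_prod_of_mem f (Finset.mem_univ j)).mul_left _).mul_left _
  set N := ⌊((M * d : ℕ) : ℝ) * x⌋₊ with hN
  have hMd0 : 0 < M * d := Nat.mul_pos hM hd0
  have hfloor : ∀ c, c ∣ M * d → c * N / (M * d) = ⌊(c : ℝ) * x⌋₊ := by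
    rintro c ⟨c', hc'⟩
    rw [hN, hc']
    have hcc : 0 < c * c' := hc' ▸ hMd0
    have hc0 : 0 < c := Nat.pos_of_mul_pos_right hcc
    have hc0' : 0 < c' := Nat.pos_of_mul_pos_left hcc
    rw [Nat.mul_div_mul_left _ _ hc0, ← Nat.floor_div_natCast]
    congr 1
    have : (c' : ℝ) ≠ 0 := by positivity
    push_cast
    field_simp
  have hNΔ : floorDiff e f N (M * d) = 0 := by
    rw [← hx0, landau_eq_natFloor hxpos, floorDiff]
    simp only [hfloor _ (hed _), hfloor _ (hfd _)]
  have hdΔ : 0 < floorDiff e f d (M * d) := floorDiff_maxTerm_pos hsum he hf hint hdisj hM hd0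
  have hdN : d < N := by
    refine lt_of_le_of_ne (Nat.le_floor ?_) ?_
    · rw [div_le_iff₀ hM'] at hx
      push_cast
      nlinarith [(Nat.cast_nonneg d : (0 : ℝ) ≤ d)]
    · intro h
      exact hdΔ.ne' ((congrArg (fun t => floorDiff e f t (M * d)) h).trans hNΔ)
  have h := shiftRatio_one_ne_zero hMd0 hed hfd (fun n => by
    rw [floorDiff_eq_landau]
    exact landau_nonneg hsum hint (by positivity)) hd0 hdN hdΔ hNΔ
  simp only [hfloor _ (hed _), hfloor _ (hfd _)] at h
  exact h

theorem finite_setOf_isPadicIntSeries (hsum : ∑ i, e i = ∑ j, f j)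
    (he : ∀ i, 0 < e i) (hf : ∀ j, 0 < f j)
    (hint : ∀ n : ℕ, ∃ k : ℤ, factorialRatio e f n = (k : ℚ)) (hdisj : ∀ i j, e i ≠ f j)
    {x : ℝ} (hx : 1 / (maxTerm e f : ℝ) ≤ x) (hx1 : x < 1) (hx0 : landau e f x = 0)
    {L : ℕ} (hL1 : 1 ≤ L) (hL : L ≤ maxTerm e f) :
    {p : ℕ | ∃ _ : Fact p.Prime, IsPadicIntSeries p (canonicalCoordL e f L)}.Finite := by
  have hM : 0 < maxTerm e f := by omega
  have hxpos : 0 ≤ x := le_trans (by positivity) hx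
  have hne := shiftRatio_floor_one_ne_zero hsum he hf hint hdisj hM hx hx0
  set E : Fin r → ℕ := fun i => ⌊(e i : ℝ) * x⌋₊ with hE
  set F : Fin s → ℕ := fun j => ⌊(f j : ℝ) * x⌋₊ with hF
  obtain ⟨N₁, hN₁⟩ := exists_forall_floorDiff_ceil (e := e) (f := f) hxpos
  obtain ⟨N₂, hN₂⟩ := exists_forall_padicNorm_eq_one
    (shiftRatio_ne_zero (e := e) (f := f) (E := E) (F := F) 0)
  obtain ⟨N₃, hN₃⟩ := exists_forall_padicNorm_eq_one
    (shiftRatio_ne_zero (e := e) (f := f) (E := E) (F := F) 1)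
  obtain ⟨N₄, hN₄⟩ := exists_forall_padicNorm_eq_one (sub_ne_zero.2 hne)
  obtain ⟨N₅, hN₅⟩ := exists_forall_padicNorm_eq_one (harmonic_pos (show L ≠ 0 by omega)).ne'
  obtain ⟨N₆, hN₆⟩ := exists_forall_padicNorm_eq_one
    (factorialRatio_ne_zero (e := e) (f := f) 1)
  obtain ⟨N₇, hN₇⟩ : ∃ N, ⌊(L : ℝ) * x⌋₊ ≠ 0 → ∀ (p : ℕ) (_ : Fact p.Prime), N < p →
      padicNorm p (harmonic ⌊(L : ℝ) * x⌋₊) = 1 := by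
    by_cases h : ⌊(L : ℝ) * x⌋₊ = 0
    · exact ⟨0, fun h' => absurd h h'⟩
    · obtain ⟨N, hN⟩ := exists_forall_padicNorm_eq_one (harmonic_pos h).ne'
      exact ⟨N, fun _ => hN⟩
  refine (Set.finite_Iic (N₁ + N₂ + N₃ + N₄ + N₅ + N₆ + N₇)).subset ?_
  rintro p ⟨hp, hq⟩
  rw [isPadicIntSeries_iff] at hq
  rw [Set.mem_Iic]
  by_contra hlt
  obtain ⟨hfl, hΔ⟩ := hN₁ p (by omega)
  rw [hx0] at hΔ
  set a := ⌈x * p⌉₊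
  -- The case `c = 1` of `hfl`, as `⌊x⌋ = 0`.
  have ha : a < p := by
    have h1 := hfl 1 hM
    rw [one_mul, Nat.cast_one, one_mul, Nat.floor_eq_zero.2 hx1] at h1
    exact (Nat.div_eq_zero_iff_lt hp.out.pos).1 h1
  -- If `⌊L x⌋ = 0`, then `p` divides the nonzero difference of the two shift ratios. Otherwise
  -- `H_{La}` is `p`-integral while `p H_{La} ≡ H_{⌊Lx⌋}` is a unit mod `p`. Both are excluded for
  -- `p` beyond the bounds.
  by_cases hLx : ⌊(L : ℝ) * x⌋₊ = 0
  · refine unit_not_mem_padicIdeal (hN₄ p hp (by omega)) ?_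
    exact shiftRatio_sub_mem hsum hint hq ha (by rw [hfl L hL, hLx])
      (fun i => hfl _ (le_maxTerm_left i)) (fun j => hfl _ (le_maxTerm_right j)) hΔ
      (hN₂ p hp (by omega)) (hN₃ p hp (by omega)) (hN₅ p hp (by omega)) (hN₆ p hp (by omega))
  · refine unit_not_mem_padicIdeal (hN₇ hLx p hp (by omega)) ?_
    have h1 := factorialRatio_mul_harmonic_mem hint hq ha
    have h2 := factorialRatio_eq (p := p) hsum a
    simp only [hfl _ (le_maxTerm_left _), hfl _ (le_maxTerm_right _), hΔ, zpow_zero, mul_one] at h2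
    rw [h2, mul_assoc, unit_mul_mem_iff (padicNorm_unitRatio a),
      unit_mul_mem_iff (hN₂ p hp (by omega))] at h1
    have h3 := prime_mul_harmonic_sub_mem (p := p) (L * a)
    rw [hfl L hL] at h3
    have h4 := sub_mem (padicIdeal_mul_of_le prime_mem_padicIdeal h1 (m := 1) (by simp)) h3
    rwa [sub_sub_cancel] at h4

/-- If `M = 1`, the jump at `1/M` would contradict `Δ(1) = ∑ e - ∑ f = 0`. -/
theorem one_lt_maxTerm (hsum : ∑ i, e i = ∑ j, f j)
    (he : ∀ i, 0 < e i) (hf : ∀ j, 0 < f j)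
    (hint : ∀ n : ℕ, ∃ k : ℤ, factorialRatio e f n = (k : ℚ)) (hdisj : ∀ i j, e i ≠ f j)
    (hM : 0 < maxTerm e f) : 1 < maxTerm e f := by
  by_contra h
  have hM1 : maxTerm e f = 1 := by omega
  have h1 := floorDiff_maxTerm_pos hsum he hf hint hdisj hM one_pos
  have h2 : ∑ i, (e i : ℤ) = ∑ j, (f j : ℤ) := by exact_mod_cast hsum
  simp [hM1, floorDiff, h2] at h1

theorem one_le_floorDiff (hsum : ∑ i, e i = ∑ j, f j) (hM : 0 < maxTerm e f)
    (h : ∀ x ∈ Set.Ico (1 / (maxTerm e f : ℝ)) 1, 1 ≤ landau e f x) (n q : ℕ) (hq : 0 < q)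
    (hnq : q ≤ maxTerm e f * (n % q)) : 1 ≤ floorDiff e f n q := by
  have hq' : (0 : ℝ) < q := by exact_mod_cast hq
  have hM' : (0 : ℝ) < maxTerm e f := by exact_mod_cast hM
  rw [floorDiff_mod hsum n q hq, floorDiff_eq_landau]
  refine h _ ⟨?_, ?_⟩
  · rw [div_le_div_iff₀ hM' hq', one_mul, mul_comm]
    exact_mod_cast hnq
  · rw [div_lt_one hq']
    exact_mod_cast Nat.mod_lt n hq

/-- The interval is nonempty, so the first alternative of the dichotomy is never vacuous. -/
theorem exists_mem_Ico (hsum : ∑ i, e i = ∑ j, f j)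
    (he : ∀ i, 0 < e i) (hf : ∀ j, 0 < f j)
    (hint : ∀ n : ℕ, ∃ k : ℤ, factorialRatio e f n = (k : ℚ)) (hdisj : ∀ i j, e i ≠ f j) :
    1 / (maxTerm e f : ℝ) ∈ Set.Ico (1 / (maxTerm e f : ℝ)) 1 := by
  refine ⟨le_rfl, ?_⟩
  -- `M = 0` means that both sequences are empty; then `1 / M = 0` by convention and the interval is
  -- `[0, 1[`.
  rcases Nat.eq_zero_or_pos (maxTerm e f) with h0 | hM
  · simp [h0]
  · have h1 : (1 : ℝ) < maxTerm e f := by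
      exact_mod_cast one_lt_maxTerm hsum he hf hint hdisj hM
    exact (div_lt_one (by linarith)).2 h1

end

end MirrorMap

/-! ### Assembly -/

theorem mainTheorem2 {r s : ℕ} (e : Fin r → ℕ) (f : Fin s → ℕ)
    (he : ∀ i, 0 < e i) (hf : ∀ j, 0 < f j)
    (hdisj : ∀ i j, e i ≠ f j)
    (hsum : ∑ i, e i = ∑ j, f j)
    (hint : ∀ n : ℕ, ∃ k : ℤ, MirrorMap.factorialRatio e f n = (k : ℚ)) :
    -- exactly one of the two cases (i), (ii) occurs
    Xor
      (∀ x ∈ Set.Ico (1 / (MirrorMap.maxTerm e f : ℝ)) 1, 1 ≤ MirrorMap.landau e f x)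
      (∃ x ∈ Set.Ico (1 / (MirrorMap.maxTerm e f : ℝ)) 1, MirrorMap.landau e f x = 0) ∧
    -- case (i)
    ((∀ x ∈ Set.Ico (1 / (MirrorMap.maxTerm e f : ℝ)) 1, 1 ≤ MirrorMap.landau e f x) →
      ∀ L ∈ Finset.Icc 1 (MirrorMap.maxTerm e f),
        MirrorMap.IsIntSeries (MirrorMap.canonicalCoordL e f L)) ∧
    -- case (ii)
    ((∃ x ∈ Set.Ico (1 / (MirrorMap.maxTerm e f : ℝ)) 1, MirrorMap.landau e f x = 0) →
      ∀ L ∈ Finset.Icc 1 (MirrorMap.maxTerm e f),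
        {p : ℕ | ∃ _ : Fact p.Prime,
          MirrorMap.IsPadicIntSeries p (MirrorMap.canonicalCoordL e f L)}.Finite) ∧
    -- integrality of all the `q_L` implies that of `q`
    ((∀ L ∈ Finset.Icc 1 (MirrorMap.maxTerm e f),
        MirrorMap.IsIntSeries (MirrorMap.canonicalCoordL e f L)) →
      MirrorMap.IsXMulIntSeries (MirrorMap.canonicalCoord e f)) ∧
    -- hence case (i) for `q` itself
    ((∀ x ∈ Set.Ico (1 / (MirrorMap.maxTerm e f : ℝ)) 1, 1 ≤ MirrorMap.landau e f x) →
      MirrorMap.IsXMulIntSeries (MirrorMap.canonicalCoord e f)) := by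
  have hmem := MirrorMap.exists_mem_Ico hsum he hf hint hdisj
  have hcase1 : (∀ x ∈ Set.Ico (1 / (MirrorMap.maxTerm e f : ℝ)) 1, 1 ≤ MirrorMap.landau e f x) →
      ∀ L ∈ Finset.Icc 1 (MirrorMap.maxTerm e f),
        MirrorMap.IsIntSeries (MirrorMap.canonicalCoordL e f L) := by
    intro h L hL
    rw [Finset.mem_Icc] at hL
    have hM : 0 < MirrorMap.maxTerm e f := by omega
    exact MirrorMap.isIntSeries_canonicalCoordL hsum hM
      (MirrorMap.one_le_floorDiff hsum hM h) hL.2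
  have hcase2 := MirrorMap.isXMulIntSeries_canonicalCoord (e := e) (f := f) he hf
  refine ⟨?_, hcase1, ?_, hcase2, fun h => hcase2 (hcase1 h)⟩
  · by_cases h : ∀ x ∈ Set.Ico (1 / (MirrorMap.maxTerm e f : ℝ)) 1, 1 ≤ MirrorMap.landau e f x
    · refine Or.inl ⟨h, ?_⟩
      rintro ⟨x, hx, hx0⟩
      have := h x hx
      omega
    · refine Or.inr ⟨?_, h⟩
      push Not at h
      obtain ⟨x, hx, hx1⟩ := h
      -- `Δ(x)` is an integer with `0 ≤ Δ(x) < 1`, hence zero.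
      have := MirrorMap.landau_nonneg hsum hint (le_trans (by positivity) hx.1)
      exact ⟨x, hx, by omega⟩
  · rintro ⟨x, hx, hx0⟩ L hL
    rw [Finset.mem_Icc] at hL
    exact MirrorMap.finite_setOf_isPadicIntSeries hsum he hf hint hdisj hx.1 hx.2 hx0 hL.1 hL.2
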